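/- Let $K$ be an infinite field, $R=K[x,y,z]$ with its standard grading, and $k\ge 3$. Let $L_1,\dots,L_4\in R$ be linear forms in general position, i.e. any three of them are linearly independent, let $I=(L_1^k,L_2^k,L_3^k,L_4^k)$, and let $h(\delta)=\dim_K[R/I]_\delta$ for $\delta\in\mathbb Z$ (so $h(\delta)=0$ for $\delta<0$). Let $L\in R$ be a linear form (for instance a general one) and let $j\ge 2$ be an integer. Then the numbers $$a:=\max\{\delta\in\mathbb Z \mid h(\delta-j)\le h(\delta),\ (h(\delta-j),h(\delta))\ne(0,0)\},$$ $$b:=\min\{\delta\in\mathbb Z \mid h(\delta-j)\ge h(\delta),\ (h(\delta-j),h(\delta))\ne(0,0)\}$$ exist. If $\times L^j:[R/I]_{a-j}\to[R/I]_a$ is injective and $\times L^j:[R/I]_{b-j}\to[R/I]_b$ is surjective, then $\times L^j:[R/I]_{\delta-j}\to[R/I]_\delta$ has maximal rank (i.e. is injective or surjective) for every $\delta\in\mathbb Z$. -/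

import Mathlib

namespace LefschetzPowers

open MvPolynomial

/-- The polynomial ring `K[x, y, z]`, with its standard grading. -/
abbrev PolyRing (K : Type*) [Field K] : Type _ := MvPolynomial (Fin 3) K

variable {K : Type*} [Field K]

/-- Four linear forms in three variables are in general position: any three of them are linearly
independent. (The family `t ↦ L (i.succAbove t)` omits the `i`-th form.) -/
def GeneralPosition (L : Fin 4 → PolyRing K) : Prop :=
  (∀ i, (L i).IsHomogeneous 1) ∧
    ∀ i : Fin 4, LinearIndependent K (fun t : Fin 3 => L (i.succAbove t))

/-- The ideal `(L₁ ^ k, L₂ ^ k, L₃ ^ k, L₄ ^ k)`. -/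
noncomputable def powerIdeal (L : Fin 4 → PolyRing K) (k : ℕ) : Ideal (PolyRing K) :=
  Ideal.span (Set.range fun i => L i ^ k)

/-- The graded component `[R/I]_d`, for `d : ℤ`: the classes of the forms of degree `d`
(and zero if `d < 0`). -/
noncomputable def component (I : Ideal (PolyRing K)) : ℤ → Submodule K (PolyRing K ⧸ I)
  | Int.ofNat n => (homogeneousSubmodule (Fin 3) K n).map (Ideal.Quotient.mkₐ K I).toLinearMap
  | Int.negSucc _ => ⊥

/-- The Hilbert function `h_{R/I}(d) = dim_K [R/I]_d`, for `d : ℤ`. -/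
noncomputable def hilbert (I : Ideal (PolyRing K)) (d : ℤ) : ℕ :=
  Module.finrank K (component I d)

theorem mul_pow_mem_component (I : Ideal (PolyRing K)) {M : PolyRing K} (hM : M.IsHomogeneous 1)
    (j : ℕ) (d : ℤ) (f : PolyRing K ⧸ I) (hf : f ∈ component I (d - j)) :
    LinearMap.mulLeft K (Ideal.Quotient.mk I M ^ j) f ∈ component I d := by
  obtain ⟨e, he⟩ : ∃ e : ℤ, e = d - j := ⟨_, rfl⟩
  rw [← he] at hf
  cases e with
  | ofNat n =>
    have hd : d = Int.ofNat (j + n) := by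
      simp only [Int.ofNat_eq_natCast, Nat.cast_add] at he ⊢
      omega
    obtain ⟨p, hp, rfl⟩ := hf
    rw [hd]
    refine ⟨M ^ j * p, ?_, ?_⟩
    · have hp' : p.IsHomogeneous n := hp
      have h := (hM.pow j).mul hp'
      rw [one_mul] at h
      exact h
    · simp
  | negSucc n =>
    have hf0 : f = 0 := hf
    rw [hf0, map_zero]
    exact Submodule.zero_mem _

/-- The multiplication map `×M^j : [R/I]_{d-j} → [R/I]_d` by the `j`-th power of a linear
form `M`. -/
noncomputable def mulPow (I : Ideal (PolyRing K)) {M : PolyRing K} (hM : M.IsHomogeneous 1) (j : ℕ) (d : ℤ) :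
    component I (d - j) →ₗ[K] component I d :=
  (LinearMap.mulLeft K (Ideal.Quotient.mk I M ^ j)).restrict (mul_pow_mem_component I hM j d)

/-- The map `×M^j : [R/I]_{d-j} → [R/I]_d` has maximal rank: it is injective or surjective. -/
def HasMaximalRank (I : Ideal (PolyRing K)) {M : PolyRing K} (hM : M.IsHomogeneous 1) (j : ℕ)
    (d : ℤ) : Prop :=
  Function.Injective (mulPow I hM j d) ∨ Function.Surjective (mulPow I hM j d)

/-- The degrees `d` such that `h(d-j) ≤ h(d)`, where `[R/I]_{d-j}` and `[R/I]_d` are not both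
zero. -/
def nondecreasingDegrees (I : Ideal (PolyRing K)) (j : ℕ) : Set ℤ :=
  {d | hilbert I (d - j) ≤ hilbert I d ∧ ¬ (hilbert I (d - j) = 0 ∧ hilbert I d = 0)}

/-- The degrees `d` such that `h(d-j) ≥ h(d)`, where `[R/I]_{d-j}` and `[R/I]_d` are not both
zero. -/
def nonincreasingDegrees (I : Ideal (PolyRing K)) (j : ℕ) : Set ℤ :=
  {d | hilbert I (d - j) ≥ hilbert I d ∧ ¬ (hilbert I (d - j) = 0 ∧ hilbert I d = 0)}

end LefschetzPowers

namespace LefschetzPowers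

open MvPolynomial Module

variable {K : Type*} [Field K]

/-! Surjectivity of `×M^j` passes to higher degrees because `R/I` is generated in degree 0.
Injectivity passes from `a` to lower degrees if `R/I` has no socle below degree `a - j`. In a degree
strictly between `a` and `b` the target is zero. So everything rests on two facts about `A = R/I`
(`powerIdeal_properties`): no socle in degrees `s` with `2s ≤ 3k - 5`, and a Hilbert function that
strictly decreases to zero from degree `(3k - 3)/2` on. The second fact forces `2(a - j) ≤ 3k - 4`
when `A` is nonzero in degree `a - j`, and then the first one applies.

In suitable coordinates `I = c + (F)` with `c = (x^k, y^k, z^k)` and `F` a form of degree `k`. The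
linked ideal `J = c : F` is Gorenstein of socle degree `2k - 3`, and `h_A(n) = h_{R/c}(n) -
h_{R/J}(n - k)`.

Decrease (`hf_sup_lt`): up to degree `2k - 2`, `h_{R/c}` drops while `h_{R/J}` does not, by
unimodality in codimension three (`hf_gor_mono`). Beyond that, symmetry turns `h_A(n)` into `dim
J_{3k-3-n}`, and the dimensions of the pieces of an ideal grow strictly once nonzero.

Socle (`mem_of_X_mul_mem_sup`): a socle element `f` gives `X_i f ≡ F p_i` mod `c`, so each `X_i p_j
- X_j p_i` lies in `J`. In that low degree all forms of `J` are multiples of one `θ ∈ J`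
(`dvd_of_mem_gor`). Koszul exactness yields `p_i = θ q_i + X_i w`, so `f - F w` is a socle element
of `R/c` below its top degree `3k - 3`, hence zero. -/

/-! ### Graded pieces indexed by the integers. -/

/-- The forms of degree `n`, for `n : ℤ`. -/
noncomputable def gr (K : Type*) [Field K] (n : ℤ) : Submodule K (PolyRing K) :=
  if 0 ≤ n then homogeneousSubmodule (Fin 3) K n.toNat else ⊥

/-- The component of degree `n` of a polynomial, for `n : ℤ`. -/
noncomputable def comp (n : ℤ) : PolyRing K →ₗ[K] PolyRing K :=
  if 0 ≤ n then homogeneousComponent n.toNat else 0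

theorem gr_natCast (n : ℕ) : gr K (n : ℤ) = homogeneousSubmodule (Fin 3) K n := by
  simp [gr]

theorem mem_gr_natCast {n : ℕ} {f : PolyRing K} : f ∈ gr K (n : ℤ) ↔ f.IsHomogeneous n := by
  rw [gr_natCast, mem_homogeneousSubmodule]

theorem gr_of_neg {n : ℤ} (h : n < 0) : gr K n = ⊥ := by
  simp [gr, not_le.mpr h]

theorem eq_zero_of_mem_gr_neg {n : ℤ} (h : n < 0) {f : PolyRing K} (hf : f ∈ gr K n) : f = 0 := by
  rwa [gr_of_neg h, Submodule.mem_bot] at hf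

theorem comp_natCast (n : ℕ) (f : PolyRing K) : comp (n : ℤ) f = homogeneousComponent n f := by
  simp [comp]

theorem comp_of_neg {n : ℤ} (h : n < 0) (f : PolyRing K) : comp n f = 0 := by
  simp [comp, not_le.mpr h]

theorem comp_mem (n : ℤ) (f : PolyRing K) : comp n f ∈ gr K n := by
  rcases lt_or_ge n 0 with h | h
  · rw [comp_of_neg h]
    exact Submodule.zero_mem _
  · lift n to ℕ using h
    rw [comp_natCast, mem_gr_natCast]
    exact homogeneousComponent_isHomogeneous _ _

theorem comp_of_mem {n : ℤ} {f : PolyRing K} (hf : f ∈ gr K n) (m : ℤ) :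
    comp m f = if m = n then f else 0 := by
  rcases lt_or_ge n 0 with h | h
  · rw [eq_zero_of_mem_gr_neg h hf]
    simp
  · lift n to ℕ using h
    rcases lt_or_ge m 0 with h' | h'
    · rw [comp_of_neg h', if_neg (by omega)]
    · lift m to ℕ using h'
      rw [comp_natCast, homogeneousComponent_of_mem (mem_gr_natCast.mp hf)]
      simp [eq_comm]

theorem comp_self {n : ℤ} {f : PolyRing K} (hf : f ∈ gr K n) : comp n f = f := by
  rw [comp_of_mem hf, if_pos rfl]

theorem mul_mem_gr {m n : ℤ} {f g : PolyRing K} (hf : f ∈ gr K m) (hg : g ∈ gr K n) :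
    f * g ∈ gr K (m + n) := by
  rcases lt_or_ge m 0 with h | h
  · rw [eq_zero_of_mem_gr_neg h hf, zero_mul]
    exact Submodule.zero_mem _
  rcases lt_or_ge n 0 with h' | h'
  · rw [eq_zero_of_mem_gr_neg h' hg, mul_zero]
    exact Submodule.zero_mem _
  lift m to ℕ using h
  lift n to ℕ using h'
  rw [← Nat.cast_add, mem_gr_natCast]
  exact (mem_gr_natCast.mp hf).mul (mem_gr_natCast.mp hg)

theorem monomial_mem_gr (d : Fin 3 →₀ ℕ) (c : K) : monomial d c ∈ gr K (d.degree : ℤ) :=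
  mem_gr_natCast.mpr (isHomogeneous_monomial c rfl)

theorem X_mem_gr (i : Fin 3) : (X i : PolyRing K) ∈ gr K 1 := by
  exact_mod_cast (mem_gr_natCast (n := 1)).mpr (isHomogeneous_X K i)

theorem X_pow_mem_gr (i : Fin 3) (k : ℕ) : (X i ^ k : PolyRing K) ∈ gr K k :=
  mem_gr_natCast.mpr (isHomogeneous_X_pow i k)

theorem comp_mul {m : ℤ} {g : PolyRing K} (hg : g ∈ gr K m) (n : ℤ) (f : PolyRing K) :
    comp n (g * f) = g * comp (n - m) f := by
  induction f using MvPolynomial.monomial_add_induction_on with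
  | C a =>
    have h : (C a : PolyRing K) ∈ gr K (0 : ℤ) := by
      exact_mod_cast (mem_gr_natCast (n := 0)).mpr (isHomogeneous_C _ a)
    rw [comp_of_mem (mul_mem_gr hg h), comp_of_mem h]
    by_cases h1 : n = m
    · simp [h1]
    · rw [if_neg (by omega), if_neg (by omega), mul_zero]
  | monomial_add d c f _ _ ih =>
    rw [mul_add, map_add, map_add, mul_add, ih]
    congr 1
    have h := monomial_mem_gr d c
    rw [comp_of_mem (mul_mem_gr hg h), comp_of_mem h]
    by_cases h1 : n = m + d.degree
    · rw [if_pos h1, if_pos (by omega)]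
    · rw [if_neg h1, if_neg (by omega), mul_zero]

instance finite_gr (n : ℤ) : Module.Finite K (gr K n) := by
  rcases lt_or_ge n 0 with h | h
  · rw [gr_of_neg h]
    infer_instance
  · lift n to ℕ using h
    rw [gr_natCast, Module.Finite.iff_fg]
    exact homogeneousSubmodule_fg (Fin 3) K n

theorem finrank_gr_natCast (n : ℕ) : finrank K (gr K (n : ℤ)) = (n + 2).choose 2 := by
  classical
  rw [gr_natCast, homogeneousSubmodule_eq_finsupp_supported]
  have e : {d : Fin 3 →₀ ℕ | d.degree = n} =
      ((Finset.univ : Finset (Fin 3)).finsuppAntidiag n : Set (Fin 3 →₀ ℕ)) := by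
    ext d
    simp [Finset.mem_finsuppAntidiag, Finsupp.degree_eq_sum]
  rw [e]
  have h := (AddMonoidAlgebra.supportedEquivFinsupp (R := K) (S := K)
    ((Finset.univ : Finset (Fin 3)).finsuppAntidiag n : Set (Fin 3 →₀ ℕ))).finrank_eq
  rw [h]
  rw [Module.finrank_finsupp_self]
  simp [Finset.card_finsuppAntidiag_nat_eq_choose]
  rw [show 2 + n = n + 2 by ring, ← Nat.choose_symm_add]

/-! ### Homogeneous ideals, colon ideals and Hilbert functions. -/

/-- An ideal stable under taking homogeneous components. -/
def IsHomog (I : Ideal (PolyRing K)) : Prop := ∀ f ∈ I, ∀ n, comp n f ∈ I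

theorem IsHomog.sup {I J : Ideal (PolyRing K)} (hI : IsHomog I) (hJ : IsHomog J) :
    IsHomog (I ⊔ J) := by
  intro f hf n
  obtain ⟨a, ha, b, hb, rfl⟩ := Submodule.mem_sup.mp hf
  rw [map_add]
  exact Submodule.add_mem_sup (hI a ha n) (hJ b hb n)

theorem isHomog_bot : IsHomog (⊥ : Ideal (PolyRing K)) := by
  intro f hf n
  rw [Submodule.mem_bot] at hf
  simp [hf]

theorem isHomog_span_singleton {g : PolyRing K} {m : ℤ} (hg : g ∈ gr K m) :
    IsHomog (Ideal.span {g}) := by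
  intro f hf n
  obtain ⟨b, rfl⟩ := Ideal.mem_span_singleton'.mp hf
  rw [mul_comm, comp_mul hg]
  exact Ideal.mul_mem_right _ _ (Ideal.mem_span_singleton_self g)

/-- The colon ideal `I : g`. -/
noncomputable def quot (I : Ideal (PolyRing K)) (g : PolyRing K) : Ideal (PolyRing K) :=
  Submodule.comap (LinearMap.mulLeft (PolyRing K) g) I

theorem mem_quot {I : Ideal (PolyRing K)} {g f : PolyRing K} : f ∈ quot I g ↔ g * f ∈ I := Iff.rfl

theorem le_quot (I : Ideal (PolyRing K)) (g : PolyRing K) : I ≤ quot I g :=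
  fun _ hf => Ideal.mul_mem_left _ _ hf

/-- The forms of degree `n` in an ideal. -/
noncomputable def piece (I : Ideal (PolyRing K)) (n : ℤ) : Submodule K (PolyRing K) :=
  gr K n ⊓ I.restrictScalars K

theorem mem_piece {I : Ideal (PolyRing K)} {n : ℤ} {f : PolyRing K} :
    f ∈ piece I n ↔ f ∈ gr K n ∧ f ∈ I := Iff.rfl

instance finite_piece (I : Ideal (PolyRing K)) (n : ℤ) : Module.Finite K (piece I n) :=
  Submodule.finiteDimensional_of_le (inf_le_left : piece I n ≤ gr K n)

theorem finrank_map_add_finrank_inf_ker {V W : Type*} [AddCommGroup V] [Module K V]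
    [AddCommGroup W] [Module K W] (f : V →ₗ[K] W) (p : Submodule K V) [Module.Finite K p] :
    finrank K (p.map f) + finrank K (p ⊓ LinearMap.ker f : Submodule K V) = finrank K p := by
  rw [← LinearMap.finrank_range_add_finrank_ker (f.domRestrict p), LinearMap.range_domRestrict,
    LinearMap.ker_domRestrict, ← Submodule.finrank_map_subtype_eq p,
    Submodule.map_comap_subtype]

/-- The Hilbert function of `R/I`, with values in `ℤ`. -/
noncomputable def hf (I : Ideal (PolyRing K)) (n : ℤ) : ℤ :=
  finrank K (gr K n) - finrank K (piece I n)

theorem ker_mkₐ (I : Ideal (PolyRing K)) :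
    LinearMap.ker (Ideal.Quotient.mkₐ K I).toLinearMap = I.restrictScalars K := by
  ext f
  simp [Ideal.Quotient.eq_zero_iff_mem]

theorem finrank_map_gr (I : Ideal (PolyRing K)) (n : ℤ) :
    (finrank K ((gr K n).map (Ideal.Quotient.mkₐ K I).toLinearMap) : ℤ) = hf I n := by
  have h := finrank_map_add_finrank_inf_ker (Ideal.Quotient.mkₐ K I).toLinearMap (gr K n)
  rw [ker_mkₐ] at h
  rw [hf, piece, ← h]
  push_cast
  ring

theorem hf_nonneg (I : Ideal (PolyRing K)) (n : ℤ) : 0 ≤ hf I n := by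
  rw [← finrank_map_gr]
  positivity

theorem hf_of_neg (I : Ideal (PolyRing K)) {n : ℤ} (hn : n < 0) : hf I n = 0 := by
  have h : piece I n = ⊥ := by
    rw [piece, gr_of_neg hn, bot_inf_eq]
  rw [hf, h, gr_of_neg hn]
  simp

theorem hf_anti {I J : Ideal (PolyRing K)} {n : ℤ} (h : ∀ f ∈ gr K n, f ∈ I → f ∈ J) :
    hf J n ≤ hf I n := by
  have : piece I n ≤ piece J n := fun f hf => ⟨hf.1, h f hf.1 hf.2⟩
  have := Submodule.finrank_mono this
  simp only [hf]
  omega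

theorem hf_eq_zero_iff {I : Ideal (PolyRing K)} {n : ℤ} :
    hf I n = 0 ↔ ∀ f ∈ gr K n, f ∈ I := by
  constructor
  · intro h f hf'
    have h2 : piece I n = gr K n := by
      apply Submodule.eq_of_le_of_finrank_eq inf_le_left
      simp only [hf] at h
      exact_mod_cast (sub_eq_zero.mp h).symm
    rw [← h2] at hf'
    exact hf'.2
  · intro h
    have h2 : piece I n = gr K n := inf_eq_left.mpr h
    rw [hf, h2, sub_self]

/-- The exact sequence `0 → (R/(I : g))(-m) → R/I → R/(I + (g)) → 0`. -/
theorem hf_exact {I : Ideal (PolyRing K)} (hI : IsHomog I) {g : PolyRing K} {m : ℤ}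
    (hg : g ∈ gr K m) (n : ℤ) :
    hf I n = hf (I ⊔ Ideal.span {g}) n + hf (quot I g) (n - m) := by
  set π := (Ideal.Quotient.mkₐ K I).toLinearMap with hπ
  -- Rank-nullity twice, for one and the same image in `R/I`: that of `×g` on forms of degree `n -
  -- m`, and that of the degree `n` part of `I + (g)`.
  have h1 := finrank_map_add_finrank_inf_ker (π ∘ₗ LinearMap.mulLeft K g) (gr K (n - m))
  have h2 := finrank_map_add_finrank_inf_ker π (piece (I ⊔ Ideal.span {g}) n)
  have e1 : gr K (n - m) ⊓ LinearMap.ker (π ∘ₗ LinearMap.mulLeft K g) = piece (quot I g) (n - m) := by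
    rw [LinearMap.ker_comp, hπ, ker_mkₐ]
    rfl
  have e2 : piece (I ⊔ Ideal.span {g}) n ⊓ LinearMap.ker π = piece I n := by
    ext f
    rw [hπ, ker_mkₐ]
    simp only [Submodule.mem_inf, mem_piece, Submodule.restrictScalars_mem]
    exact ⟨fun h => ⟨h.1.1, h.2⟩, fun h => ⟨⟨h.1, Ideal.mem_sup_left h.2⟩, h.2⟩⟩
  have e3 : (gr K (n - m)).map (π ∘ₗ LinearMap.mulLeft K g) =
      (piece (I ⊔ Ideal.span {g}) n).map π := by
    ext y
    simp only [Submodule.mem_map]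
    constructor
    · rintro ⟨f, hf, rfl⟩
      refine ⟨g * f, ⟨?_, ?_⟩, rfl⟩
      · have := mul_mem_gr hg hf
        rwa [add_sub_cancel] at this
      · exact Ideal.mem_sup_right (Ideal.mul_mem_right _ _ (Ideal.mem_span_singleton_self g))
    · rintro ⟨f, ⟨hf1, hf2⟩, rfl⟩
      obtain ⟨a, ha, b, hb, rfl⟩ := Submodule.mem_sup.mp hf2
      obtain ⟨b, rfl⟩ := Ideal.mem_span_singleton'.mp hb
      refine ⟨comp (n - m) b, comp_mem _ _, ?_⟩
      have h := comp_self hf1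
      rw [map_add, mul_comm b g, comp_mul hg] at h
      rw [mul_comm b g, ← h, map_add]
      have h0 : π (comp n a) = 0 := by
        simpa [hπ, Ideal.Quotient.eq_zero_iff_mem] using hI a ha n
      rw [h0, zero_add]
      rfl
  rw [e1, e3] at h1
  rw [e2] at h2
  simp only [hf]
  omega

/-- The quadratic polynomial also vanishes at `-1` and `-2`; these two extra degrees make the later
vanishing bounds sharp. -/
theorem two_mul_finrank_gr {n : ℤ} (hn : -2 ≤ n) :
    2 * (finrank K (gr K n) : ℤ) = (n + 2) * (n + 1) := by
  rcases lt_or_ge n 0 with h | h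
  · have : n = -1 ∨ n = -2 := by omega
    rw [gr_of_neg h]
    rcases this with rfl | rfl <;> simp
  · lift n to ℕ using h
    rw [finrank_gr_natCast]
    have h1 := Nat.triangle_succ (n + 1)
    have h2 : (n + 2).choose 2 * 2 = (n + 2) * (n + 1) := by
      rw [Nat.choose_two_right, Nat.div_mul_cancel (Nat.even_mul_pred_self _).two_dvd]
      rfl
    zify at h2
    linarith

/-! ### Gorenstein ideals and the symmetry of their Hilbert functions. -/

/-- The ideal of all `f` with `φ (f * g) = 0` for all `g` (Macaulay's inverse system of a linear
functional). -/
noncomputable def gor (φ : PolyRing K →ₗ[K] K) : Ideal (PolyRing K) where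
  carrier := {f | ∀ g, φ (f * g) = 0}
  add_mem' := by
    intro a b ha hb g
    rw [add_mul, map_add, ha g, hb g, add_zero]
  zero_mem' := by
    intro g
    rw [zero_mul, map_zero]
  smul_mem' := by
    intro c f hf g
    rw [smul_eq_mul, mul_comm c f, mul_assoc]
    exact hf _

theorem mem_gor {φ : PolyRing K →ₗ[K] K} {f : PolyRing K} : f ∈ gor φ ↔ ∀ g, φ (f * g) = 0 :=
  Iff.rfl

theorem apply_eq_zero_of_mem_gor {φ : PolyRing K →ₗ[K] K} {f : PolyRing K} (hf : f ∈ gor φ) :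
    φ f = 0 := by
  have := hf 1
  rwa [mul_one] at this

/-- A functional that only sees the component of degree `e`. -/
def SuppIn (φ : PolyRing K →ₗ[K] K) (e : ℤ) : Prop := ∀ f, φ f = φ (comp e f)

theorem SuppIn.comp_mulLeft {φ : PolyRing K →ₗ[K] K} {e : ℤ} (hφ : SuppIn φ e) {m : ℤ}
    {g : PolyRing K} (hg : g ∈ gr K m) : SuppIn (φ ∘ₗ LinearMap.mulLeft K g) (e - m) := by
  intro f
  simp only [LinearMap.comp_apply, LinearMap.mulLeft_apply]
  rw [hφ (g * f), comp_mul hg]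

theorem quot_gor (φ : PolyRing K →ₗ[K] K) (g : PolyRing K) :
    quot (gor φ) g = gor (φ ∘ₗ LinearMap.mulLeft K g) := by
  ext f
  simp only [mem_quot, mem_gor, LinearMap.comp_apply, LinearMap.mulLeft_apply, mul_assoc]

theorem mem_gor_iff_of_mem_gr {φ : PolyRing K →ₗ[K] K} {e : ℤ} (hφ : SuppIn φ e) {n : ℤ}
    {f : PolyRing K} (hf : f ∈ gr K n) : f ∈ gor φ ↔ ∀ g ∈ gr K (e - n), φ (f * g) = 0 := by
  refine ⟨fun h g _ => h g, fun h g => ?_⟩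
  rw [hφ, comp_mul hf]
  exact h _ (comp_mem _ _)

theorem isHomog_gor {φ : PolyRing K →ₗ[K] K} {e : ℤ} (hφ : SuppIn φ e) : IsHomog (gor φ) := by
  intro f hf n
  rw [mem_gor_iff_of_mem_gr hφ (comp_mem n f)]
  intro g hg
  have h := hf g
  rw [hφ, mul_comm, comp_mul hg, mul_comm] at h
  rwa [show e - (e - n) = n by ring] at h

theorem finrank_range_flip {V W : Type*} [AddCommGroup V] [Module K V] [AddCommGroup W]
    [Module K W] [Module.Finite K W] (B : V →ₗ[K] W →ₗ[K] K) :
    finrank K (LinearMap.range B.flip) = finrank K (LinearMap.range B) := by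
  have h : B.flip = B.dualMap ∘ₗ (Module.evalEquiv K W).toLinearMap := by
    ext w v
    simp
  rw [h, LinearMap.range_comp_of_range_eq_top _ (Module.evalEquiv K W).range,
    LinearMap.finrank_range_dualMap_eq_finrank_range]

/-- The left kernel of the pairing `(x, y) ↦ φ (x * y)` is the degree `i` part of the ideal.
Symmetry then follows, since a pairing and its flip have equal rank. -/
theorem hf_gor_eq_finrank_range {φ : PolyRing K →ₗ[K] K} {e : ℤ} (hφ : SuppIn φ e) {i j : ℤ}
    (h : i + j = e) (B : gr K i →ₗ[K] gr K j →ₗ[K] K) (hB : ∀ x y, B x y = φ (x * y)) :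
    hf (gor φ) i = finrank K (LinearMap.range B) := by
  have h1 := LinearMap.finrank_range_add_finrank_ker B
  have h2 : finrank K (LinearMap.ker B) = finrank K (piece (gor φ) i) := by
    suffices (LinearMap.ker B).map (gr K i).subtype = piece (gor φ) i by
      rw [← this, Submodule.finrank_map_subtype_eq]
    ext f
    simp only [Submodule.mem_map, LinearMap.mem_ker, Submodule.subtype_apply, mem_piece]
    constructor
    · rintro ⟨f, hf, rfl⟩
      refine ⟨f.2, (mem_gor_iff_of_mem_gr hφ f.2).mpr fun g hg => ?_⟩
      rw [show e - i = j by omega] at hg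
      have := hB f ⟨g, hg⟩
      rw [hf] at this
      exact this.symm
    · rintro ⟨hf1, hf2⟩
      refine ⟨⟨f, hf1⟩, ?_, rfl⟩
      ext y
      rw [hB]
      exact hf2 _
  rw [hf]
  omega

/-- Symmetry of the Hilbert function of a graded Gorenstein algebra. -/
theorem hf_gor_symm {φ : PolyRing K →ₗ[K] K} {e : ℤ} (hφ : SuppIn φ e) {i j : ℤ}
    (h : i + j = e) : hf (gor φ) i = hf (gor φ) j := by
  let B : gr K i →ₗ[K] gr K j →ₗ[K] K :=
    ((LinearMap.mul K (PolyRing K)).compr₂ φ).domRestrict₁₂ (gr K i) (gr K j)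
  rw [hf_gor_eq_finrank_range hφ h B (fun x y => rfl),
    hf_gor_eq_finrank_range hφ (by omega) B.flip (fun x y => ?_), finrank_range_flip]
  rw [mul_comm]
  rfl

/-! ### Unimodality in codimension three. -/

theorem aeval_line {n : ℕ} {f : PolyRing K} (hf : f.IsHomogeneous n) (P : Fin 3 → K) :
    aeval (fun i => C (P i) * X 2 : Fin 3 → PolyRing K) f = C (eval P f) * X 2 ^ n := by
  rw [aeval_def, eval₂_eq', eval_eq', map_sum, Finset.sum_mul]
  refine Finset.sum_congr rfl fun d hd => ?_
  have h : ∑ i, d i = n := by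
    rw [← Finsupp.degree_eq_sum]
    exact hf.degree_eq_sum_deg_support hd |>.symm
  simp only [mul_pow, Finset.prod_mul_distrib, Finset.prod_pow_eq_pow_sum, h, map_mul, map_prod,
    map_pow, algebraMap_eq]
  ring

theorem exists_eval_ne_zero [Infinite K] {n : ℕ} {f : PolyRing K} (hf : f.IsHomogeneous n)
    (h0 : f ≠ 0) : ∃ P : Fin 3 → K, P 2 = 1 ∧ eval P f ≠ 0 := by
  -- The factor `X 2` forces a nonzero last coordinate, which homogeneity allows to be scaled to 1.
  have h : ∃ Q : Fin 3 → K, eval Q (X 2 * f) ≠ 0 := by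
    by_contra! h
    exact mul_ne_zero (X_ne_zero 2) h0 (MvPolynomial.funext fun x => by rw [h x, map_zero])
  obtain ⟨Q, hQ⟩ := h
  rw [map_mul, eval_X] at hQ
  have h2 := left_ne_zero_of_mul hQ
  refine ⟨fun i => Q i * (Q 2)⁻¹, mul_inv_cancel₀ h2, ?_⟩
  have hcomp : (eval fun _ => (Q 2)⁻¹).comp
      (aeval (fun i => C (Q i) * X 2 : Fin 3 → PolyRing K)).toRingHom =
        eval fun i => Q i * (Q 2)⁻¹ := by
    ext <;> simp
  have h4 : eval (fun i => Q i * (Q 2)⁻¹) f = eval Q f * (Q 2)⁻¹ ^ n := by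
    rw [← hcomp, RingHom.comp_apply, AlgHom.toRingHom_eq_coe, RingHom.coe_coe, aeval_line hf]
    simp
  rw [h4]
  exact mul_ne_zero (right_ne_zero_of_mul hQ) (pow_ne_zero _ (inv_ne_zero h2))

/-- A nonzero form of degree `m` in `I` yields two linear forms modulo which `R/I` vanishes in
degrees at least `m`. -/
theorem exists_linear_forms [Infinite K] {I : Ideal (PolyRing K)} {m : ℕ} {θ : PolyRing K}
    (hθ : θ.IsHomogeneous m) (hθ0 : θ ≠ 0) (hθI : θ ∈ I) :
    ∃ M ∈ gr K 1, ∃ u ∈ gr K 1, ∀ n : ℤ, m ≤ n →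
      ∀ f ∈ gr K n, f ∈ I ⊔ Ideal.span {M} ⊔ Ideal.span {u} := by
  obtain ⟨P, hP2, hP⟩ := exists_eval_ne_zero hθ hθ0
  have hlin : ∀ i : Fin 3, (X i - C (P i) * X 2 : PolyRing K) ∈ gr K 1 := by
    intro i
    refine Submodule.sub_mem _ (X_mem_gr i) ?_
    rw [← smul_eq_C_mul]
    exact Submodule.smul_mem _ _ (X_mem_gr 2)
  refine ⟨_, hlin 0, _, hlin 1, fun n hn f hf => ?_⟩
  -- Modulo the two linear forms vanishing at `P`, every form is its value at `P` times a power of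
  -- `X 2`; `θ` therefore kills `X 2 ^ m`.
  set J := I ⊔ Ideal.span {X 0 - C (P 0) * X 2} ⊔ Ideal.span {X 1 - C (P 1) * X 2} with hJ
  have hmk : ∀ g : PolyRing K, Ideal.Quotient.mkₐ K J g =
      Ideal.Quotient.mkₐ K J (aeval (fun i => C (P i) * X 2 : Fin 3 → PolyRing K) g) := by
    intro g
    rw [← AlgHom.comp_apply]
    congr 1
    ext i
    rw [AlgHom.comp_apply, aeval_X]
    refine (Ideal.Quotient.eq).mpr ?_
    fin_cases i
    · exact Ideal.mem_sup_left (Ideal.mem_sup_right (Ideal.mem_span_singleton_self _))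
    · exact Ideal.mem_sup_right (Ideal.mem_span_singleton_self _)
    · simp [hP2]
  have hz : Ideal.Quotient.mkₐ K J (X 2 ^ m) = 0 := by
    have h1 := hmk θ
    rw [aeval_line hθ, ← smul_eq_C_mul, map_smul] at h1
    have h2 : Ideal.Quotient.mkₐ K J θ = 0 :=
      Ideal.Quotient.eq_zero_iff_mem.mpr (Ideal.mem_sup_left (Ideal.mem_sup_left hθI))
    rw [h2] at h1
    exact (smul_eq_zero.mp h1.symm).resolve_left hP
  lift n to ℕ using by omega
  rw [← Ideal.Quotient.eq_zero_iff_mem]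
  have h1 := hmk f
  rw [aeval_line (mem_gr_natCast.mp hf), show n = m + (n - m) by omega, pow_add, map_mul, map_mul,
    hz, zero_mul, mul_zero] at h1
  exact h1

theorem hf_step {I : Ideal (PolyRing K)} (hI : IsHomog I) {u : PolyRing K} (hu : u ∈ gr K 1)
    {n : ℤ} (h : ∀ f ∈ gr K (n + 1), f ∈ I ⊔ Ideal.span {u}) : hf I (n + 1) ≤ hf I n := by
  rw [hf_exact hI hu (n + 1), hf_eq_zero_iff.mpr h, zero_add, add_sub_cancel_right]
  exact hf_anti fun f _ hf => le_quot I u hf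

theorem hf_bot (n : ℤ) : hf (⊥ : Ideal (PolyRing K)) n = finrank K (gr K n) := by
  have : piece (⊥ : Ideal (PolyRing K)) n = ⊥ := by
    rw [eq_bot_iff]
    exact fun f hf => hf.2
  rw [hf, this]
  simp

theorem finrank_gr_mono (n : ℤ) : (finrank K (gr K n) : ℤ) ≤ finrank K (gr K (n + 1)) := by
  rcases lt_or_ge n 0 with h | h
  · rw [gr_of_neg h]
    simp
  · have h1 := two_mul_finrank_gr (K := K) (n := n) (by omega)
    have h2 := two_mul_finrank_gr (K := K) (n := n + 1) (by omega)
    nlinarith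

theorem hf_le_finrank_gr (I : Ideal (PolyRing K)) (n : ℤ) : hf I n ≤ finrank K (gr K n) := by
  simp [hf]

/-- The Hilbert function of a graded Gorenstein algebra of codimension three is unimodal. -/
theorem hf_gor_mono [Infinite K] {φ : PolyRing K →ₗ[K] K} {e : ℤ} (hφ : SuppIn φ e) {i : ℤ}
    (h : 2 * i + 1 ≤ e) : hf (gor φ) i ≤ hf (gor φ) (i + 1) := by
  by_cases hex : ∃ m : ℕ, (m : ℤ) ≤ i + 1 ∧ ∃ θ : PolyRing K, θ.IsHomogeneous m ∧ θ ≠ 0 ∧ θ ∈ gor φ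
  · obtain ⟨m, hm, θ, hθ, hθ0, hθI⟩ := hex
    obtain ⟨M, hM, u, hu, hMu⟩ := exists_linear_forms hθ hθ0 hθI
    have hhom : IsHomog (gor φ ⊔ Ideal.span {M}) :=
      (isHomog_gor hφ).sup (isHomog_span_singleton hM)
    have hdec : ∀ j : ℕ, hf (gor φ ⊔ Ideal.span {M}) (i + 1 + j) ≤
        hf (gor φ ⊔ Ideal.span {M}) (i + 1) := by
      intro j
      induction j with
      | zero => simp
      | succ j ih =>
        refine le_trans ?_ ih
        rw [Nat.cast_succ, ← add_assoc]
        exact hf_step hhom hu (hMu _ (by omega))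
    -- Compare degrees `i + 1` and `e - i`. The colon by `M` is Gorenstein of socle degree `e - 1`,
    -- so its two contributions agree by symmetry. What remains is `R/(I, M)`, whose Hilbert
    -- function does not increase from `i + 1` on; finally `h(e - i) = h(i)`.
    have h1 := hf_exact (isHomog_gor hφ) hM (i + 1)
    have h2 := hf_exact (isHomog_gor hφ) hM (e - i)
    rw [quot_gor] at h1 h2
    have h3 := hf_gor_symm hφ (i := i) (j := e - i) (by ring)
    have h4 := hf_gor_symm (hφ.comp_mulLeft hM) (i := i + 1 - 1) (j := e - i - 1) (by ring)
    have h5 := hdec (e - i - (i + 1)).toNat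
    rw [Int.toNat_of_nonneg (by omega), show i + 1 + (e - i - (i + 1)) = e - i by ring] at h5
    omega
  · push Not at hex
    have h1 : piece (gor φ) (i + 1) = ⊥ := by
      rw [eq_bot_iff]
      rintro f ⟨hf1, hf2⟩
      rw [Submodule.mem_bot]
      by_contra hf0
      rcases lt_or_ge (i + 1) 0 with hi | hi
      · exact hf0 (eq_zero_of_mem_gr_neg hi hf1)
      · lift i + 1 to ℕ using hi with m hm
        exact hex m le_rfl f (mem_gr_natCast.mp hf1) hf0 hf2
    have h2 : hf (gor φ) (i + 1) = finrank K (gr K (i + 1)) := by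
      rw [hf, h1]
      simp
    rw [h2]
    exact (hf_le_finrank_gr _ _).trans (finrank_gr_mono i)

/-! ### The Koszul complex and coprime pairs. -/

theorem X_dvd_of_dvd_X_mul {i j : Fin 3} (hij : i ≠ j) {f : PolyRing K}
    (h : (X i : PolyRing K) ∣ X j * f) : (X i : PolyRing K) ∣ f :=
  ((MvPolynomial.X_prime (i := i)).dvd_or_dvd h).resolve_left fun h' => hij ((X_dvd_X).mp h')

/-- Exactness of the Koszul complex at the first spot. -/
theorem exists_of_X_mul_eq {p : Fin 3 → PolyRing K} (h1 : X 1 * p 0 = X 0 * p 1)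
    (h2 : X 2 * p 0 = X 0 * p 2) : ∃ w, ∀ i, p i = X i * w := by
  obtain ⟨w, hw⟩ : (X 0 : PolyRing K) ∣ p 0 := X_dvd_of_dvd_X_mul (j := 1) (by decide) ⟨_, h1⟩
  refine ⟨w, fun i => ?_⟩
  have hX : (X 0 : PolyRing K) ≠ 0 := X_ne_zero 0
  fin_cases i
  · exact hw
  · apply mul_left_cancel₀ hX
    change X 0 * p 1 = X 0 * (X 1 * w)
    rw [← h1, hw]
    ring
  · apply mul_left_cancel₀ hX
    change X 0 * p 2 = X 0 * (X 2 * w)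
    rw [← h2, hw]
    ring

theorem exists_of_aeval_eq_zero {f : PolyRing K}
    (hf : aeval (![0, 0, X 2] : Fin 3 → PolyRing K) f = 0) : ∃ p q, f = X 1 * p - X 0 * q := by
  have hmk : Ideal.Quotient.mkₐ K (Ideal.span {(X 0 : PolyRing K), X 1}) f =
      Ideal.Quotient.mkₐ K (Ideal.span {(X 0 : PolyRing K), X 1})
        (aeval (![0, 0, X 2] : Fin 3 → PolyRing K) f) := by
    rw [← AlgHom.comp_apply]
    congr 1
    ext i
    rw [AlgHom.comp_apply, aeval_X]
    refine (Ideal.Quotient.eq).mpr ?_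
    fin_cases i
    · simpa using Ideal.subset_span (by simp)
    · simpa using Ideal.subset_span (by simp)
    · simp
  rw [hf, map_zero] at hmk
  obtain ⟨a, b, hab⟩ := Ideal.mem_span_pair.mp (Ideal.Quotient.eq_zero_iff_mem.mp hmk)
  exact ⟨b, -a, by rw [← hab]; ring⟩

/-- Exactness of the Koszul complex at the second spot. -/
theorem exists_curl {α β γ : PolyRing K} (h : X 0 * α + X 1 * β + X 2 * γ = 0) :
    ∃ p : Fin 3 → PolyRing K, α = X 2 * p 1 - X 1 * p 2 ∧ β = X 0 * p 2 - X 2 * p 0 ∧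
      γ = X 1 * p 0 - X 0 * p 1 := by
  -- Setting `X 0 = X 1 = 0` leaves only the `γ` term, so `γ` lies in the ideal of the first two
  -- variables.
  have h1 := congrArg (aeval (![0, 0, X 2] : Fin 3 → PolyRing K)) h
  simp only [map_add, map_mul, aeval_X, map_zero] at h1
  have h2 : (X 2 : PolyRing K) * aeval (![0, 0, X 2] : Fin 3 → PolyRing K) γ = 0 := by
    simpa using h1
  obtain ⟨p, q, hpq⟩ := exists_of_aeval_eq_zero
    ((mul_eq_zero.mp h2).resolve_left (X_ne_zero 2))
  have h3 : X 0 * (α - X 2 * q) = X 1 * -(β + X 2 * p) := by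
    rw [hpq] at h
    linear_combination h
  obtain ⟨r, hr⟩ : (X 0 : PolyRing K) ∣ -(β + X 2 * p) :=
    X_dvd_of_dvd_X_mul (j := 1) (by decide) ⟨_, h3.symm⟩
  refine ⟨![p, q, -r], ?_, ?_, hpq⟩
  · apply mul_left_cancel₀ (X_ne_zero (R := K) (0 : Fin 3))
    simp only [Matrix.cons_val]
    rw [hr] at h3
    linear_combination h3
  · simp only [Matrix.cons_val]
    linear_combination -hr

theorem dvd_of_dvd_X_mul {b h : PolyRing K} (hb : ∀ i, b ∣ X i * h) : b ∣ h := by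
  by_cases hb0 : b = 0
  · have := hb 0
    rw [hb0, zero_dvd_iff] at this
    rw [(mul_eq_zero.mp this).resolve_left (X_ne_zero 0)]
    exact dvd_zero b
  choose c hc using hb
  obtain ⟨w, hw⟩ : (X 0 : PolyRing K) ∣ c 0 := by
    apply X_dvd_of_dvd_X_mul (j := 1) (by decide)
    refine ⟨c 1, mul_left_cancel₀ hb0 ?_⟩
    linear_combination X 0 * hc 1 - X 1 * hc 0
  refine ⟨w, mul_left_cancel₀ (X_ne_zero (R := K) (0 : Fin 3)) ?_⟩
  rw [hc 0, hw]
  ring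

/-- The quotient of `R` by two coprime polynomials has no socle. -/
theorem mem_of_X_mul_mem {a b : PolyRing K} (hab : IsRelPrime a b) {g : PolyRing K}
    (hg : ∀ i, X i * g ∈ Ideal.span {a} ⊔ Ideal.span {b}) :
    g ∈ Ideal.span {a} ⊔ Ideal.span {b} := by
  simp only [← Ideal.span_insert, Ideal.mem_span_pair] at hg ⊢
  by_cases hb0 : b = 0
  · rw [hb0, isRelPrime_zero_right] at hab
    obtain ⟨u, hu⟩ := hab.exists_left_inv
    exact ⟨g * u, 0, by rw [hb0]; linear_combination g * hu⟩
  choose A B hAB using hg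
  -- Eliminating `g` gives a multiple of `b` after multiplication by `a`. The quotients by `b` form
  -- a Koszul cycle, which allows `A` to be corrected modulo `b` to a multiple of the variables.
  have hdvd : ∀ i j, b ∣ X j * A i - X i * A j := by
    intro i j
    apply hab.symm.dvd_of_dvd_mul_right (z := a)
    exact ⟨-(X j * B i - X i * B j), by linear_combination X j * hAB i - X i * hAB j⟩
  obtain ⟨t0, ht0⟩ := hdvd 1 2
  obtain ⟨t1, ht1⟩ := hdvd 2 0
  obtain ⟨t2, ht2⟩ := hdvd 0 1
  obtain ⟨p, hp0, hp1, hp2⟩ := exists_curl (α := t0) (β := t1) (γ := t2) (by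
    apply mul_left_cancel₀ hb0
    linear_combination -X 0 * ht0 - X 1 * ht1 - X 2 * ht2)
  obtain ⟨w, hw⟩ := exists_of_X_mul_eq (p := fun i => A i - b * p i)
    (by linear_combination ht2 + b * hp2) (by linear_combination -ht1 - b * hp1)
  obtain ⟨c, hc⟩ : b ∣ g - w * a := dvd_of_dvd_X_mul fun i =>
    ⟨p i * a + B i, by linear_combination -hAB i + a * hw i⟩
  exact ⟨w, c, by linear_combination -hc⟩

/-! ### Regular elements and complete intersections. -/

/-- Prime avoidance over an infinite field: each associated prime excludes a proper subspace of
coefficient vectors. Were it all of `K^3`, the prime would contain every variable and the element it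
annihilates would be a nonzero socle element. -/
theorem exists_nonzerodivisor [Infinite K] {I : Ideal (PolyRing K)}
    (hI : ∀ g, (∀ i, X i * g ∈ I) → g ∈ I) (k : ℕ) :
    ∃ c : Fin 3 → K, ∀ f, (∑ i, C (c i) * X i ^ k) * f ∈ I → f ∈ I := by
  let S : Ideal (PolyRing K) → Submodule K (Fin 3 → K) := fun P =>
    (P.restrictScalars K).comap
      (∑ i : Fin 3, (LinearMap.toSpanSingleton K (PolyRing K) (X i ^ k)) ∘ₗ LinearMap.proj i)
  have hS : ∀ P c, c ∈ S P ↔ ∑ i, C (c i) * X i ^ k ∈ P := by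
    intro P c
    simp [S, smul_eq_C_mul]
  have hfin := associatedPrimes.finite (PolyRing K) (PolyRing K ⧸ I)
  classical
  have htop : ⊤ ∉ hfin.toFinset.image S := by
    intro h
    obtain ⟨P, hP, hPS⟩ := Finset.mem_image.mp h
    rw [Set.Finite.mem_toFinset, AssociatedPrimes.mem_iff, isAssociatedPrime_iff] at hP
    obtain ⟨hprime, x, hx⟩ := hP
    obtain ⟨g, rfl⟩ := Ideal.Quotient.mk_surjective x
    have hX : ∀ i, (X i : PolyRing K) ∈ P := by
      intro i
      refine hprime.mem_of_pow_mem k ?_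
      have h1 := (hS P (Pi.single i 1)).mp (hPS ▸ Submodule.mem_top)
      simpa [Pi.single_apply, apply_ite C, ite_mul] using h1
    have hg : g ∈ I := by
      refine hI g fun i => ?_
      have h1 := hX i
      rw [hx, Submodule.mem_colon_singleton, Submodule.mem_bot] at h1
      exact Ideal.Quotient.eq_zero_iff_mem.mp h1
    apply hprime.ne_top
    rw [hx, Ideal.Quotient.eq_zero_iff_mem.mpr hg]
    simp
  obtain ⟨c, hc⟩ := (Set.ne_univ_iff_exists_notMem _).mp
    (Subspace.biUnion_ne_univ_of_top_notMem htop)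
  refine ⟨c, fun f hf => ?_⟩
  by_contra hfI
  have hz : (∑ i, C (c i) * X i ^ k : PolyRing K) ∈
      ⋃ p ∈ associatedPrimes (PolyRing K) (PolyRing K ⧸ I), (p : Set (PolyRing K)) := by
    rw [biUnion_associatedPrimes_eq_zero_divisors]
    exact ⟨Ideal.Quotient.mk I f, fun h => hfI (Ideal.Quotient.eq_zero_iff_mem.mp h),
      Ideal.Quotient.eq_zero_iff_mem.mpr hf⟩
  obtain ⟨P, hP, hmem⟩ := Set.mem_iUnion₂.mp hz
  exact hc (Set.mem_iUnion₂.mpr ⟨S P, Finset.mem_image_of_mem S (hfin.mem_toFinset.mpr hP),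
    (hS P c).mpr hmem⟩)

theorem hf_complete_intersection {a b κ : PolyRing K} {w₁ w₂ k : ℤ} (ha : a ∈ gr K w₁)
    (hb : b ∈ gr K w₂) (hκ : κ ∈ gr K k) (ha0 : a ≠ 0) (hab : IsRelPrime a b)
    (hreg : ∀ f, κ * f ∈ Ideal.span {a} ⊔ Ideal.span {b} → f ∈ Ideal.span {a} ⊔ Ideal.span {b})
    (n : ℤ) : hf (Ideal.span {a} ⊔ Ideal.span {b} ⊔ Ideal.span {κ}) n =
      finrank K (gr K n) - finrank K (gr K (n - w₁)) - finrank K (gr K (n - w₂)) +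
        finrank K (gr K (n - w₂ - w₁)) - (finrank K (gr K (n - k)) - finrank K (gr K (n - k - w₁)) -
          finrank K (gr K (n - k - w₂)) + finrank K (gr K (n - k - w₂ - w₁))) := by
  have h1 : ∀ m, hf (Ideal.span {a}) m = finrank K (gr K m) - finrank K (gr K (m - w₁)) := by
    intro m
    have h := hf_exact isHomog_bot ha m
    have hq : quot ⊥ a = ⊥ := by
      rw [eq_bot_iff]
      intro f hf
      exact (mul_eq_zero.mp (show a * f = 0 from hf)).resolve_left ha0
    rw [hq, bot_sup_eq, hf_bot, hf_bot] at h
    omega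
  have h2 : ∀ m, hf (Ideal.span {a} ⊔ Ideal.span {b}) m =
      hf (Ideal.span {a}) m - hf (Ideal.span {a}) (m - w₂) := by
    intro m
    have h := hf_exact (isHomog_span_singleton ha) hb m
    have hq : quot (Ideal.span {a}) b = Ideal.span {a} := by
      refine le_antisymm (fun f hf => ?_) (le_quot _ _)
      rw [Ideal.mem_span_singleton]
      exact hab.dvd_of_dvd_mul_left (Ideal.mem_span_singleton.mp hf)
    rw [hq] at h
    omega
  have h3 := hf_exact ((isHomog_span_singleton ha).sup (isHomog_span_singleton hb)) hκ n
  have hq : quot (Ideal.span {a} ⊔ Ideal.span {b}) κ = Ideal.span {a} ⊔ Ideal.span {b} :=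
    le_antisymm hreg (le_quot _ _)
  rw [hq] at h3
  have h4 := h2 n
  have h5 := h2 (n - k)
  rw [h1, h1] at h4 h5
  omega

/-- From this degree on all arguments in the Hilbert function formula are at least `-2`, so it is a
third difference of a quadratic polynomial, hence zero. -/
theorem mem_complete_intersection {a b κ : PolyRing K} {w₁ w₂ k : ℤ} (ha : a ∈ gr K w₁)
    (hb : b ∈ gr K w₂) (hκ : κ ∈ gr K k) (ha0 : a ≠ 0) (hab : IsRelPrime a b)
    (hreg : ∀ f, κ * f ∈ Ideal.span {a} ⊔ Ideal.span {b} → f ∈ Ideal.span {a} ⊔ Ideal.span {b})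
    (hw₁ : 0 ≤ w₁) (hw₂ : 0 ≤ w₂) (hk : 0 ≤ k)
    {n : ℤ} (hn : w₁ + w₂ + k - 2 ≤ n) {f : PolyRing K} (hf : f ∈ gr K n) :
    f ∈ Ideal.span {a} ⊔ Ideal.span {b} ⊔ Ideal.span {κ} := by
  refine hf_eq_zero_iff.mp ?_ f hf
  rw [hf_complete_intersection ha hb hκ ha0 hab hreg]
  have t := fun (m : ℤ) (hm : -2 ≤ m) => two_mul_finrank_gr (K := K) hm
  linarith [t n (by omega), t (n - w₁) (by omega), t (n - w₂) (by omega),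
    t (n - w₂ - w₁) (by omega), t (n - k) (by omega), t (n - k - w₁) (by omega),
    t (n - k - w₂) (by omega), t (n - k - w₂ - w₁) (by omega)]

/-! ### Factors of forms are forms. -/

/-- The homomorphism `f ↦ f(T x, T y, T z)`. -/
noncomputable def dilate : PolyRing K →ₐ[K] Polynomial (PolyRing K) :=
  aeval fun i => Polynomial.C (X i) * Polynomial.X

theorem dilate_of_isHomogeneous {n : ℕ} {f : PolyRing K} (hf : f.IsHomogeneous n) :
    dilate f = Polynomial.C f * Polynomial.X ^ n := by
  conv_rhs => rw [f.as_sum, map_sum, Finset.sum_mul]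
  rw [dilate, aeval_def, eval₂_eq']
  refine Finset.sum_congr rfl fun d hd => ?_
  have h : ∑ i, d i = n := by
    rw [← Finsupp.degree_eq_sum]
    exact hf.degree_eq_sum_deg_support hd |>.symm
  rw [monomial_eq, Finsupp.prod_fintype _ _ (by simp)]
  simp only [mul_pow, Finset.prod_mul_distrib, Finset.prod_pow_eq_pow_sum, h, map_mul, map_prod,
    map_pow]
  rw [show algebraMap K (Polynomial (PolyRing K)) (coeff d f) = Polynomial.C (C (coeff d f)) from
    rfl]
  ring

theorem coeff_dilate (f : PolyRing K) (n : ℕ) :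
    (dilate f).coeff n = homogeneousComponent n f := by
  conv_lhs => rw [← sum_homogeneousComponent f, map_sum, Polynomial.finsetSum_coeff]
  simp only [dilate_of_isHomogeneous (homogeneousComponent_isHomogeneous _ f),
    Polynomial.coeff_C_mul_X_pow]
  rw [Finset.sum_ite_eq]
  split_ifs with h
  · rfl
  · rw [homogeneousComponent_eq_zero]
    simpa using h

theorem isHomogeneous_of_natDegree_eq {f : PolyRing K}
    (h : (dilate f).natDegree = (dilate f).natTrailingDegree) :
    f.IsHomogeneous (dilate f).natDegree := by
  have h1 : homogeneousComponent (dilate f).natDegree f = f := by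
    conv_rhs => rw [← sum_homogeneousComponent f]
    by_cases hm : (dilate f).natDegree ∈ Finset.range (f.totalDegree + 1)
    · rw [Finset.sum_eq_single_of_mem _ hm]
      intro i _ hi
      rw [← coeff_dilate]
      rcases lt_or_gt_of_ne hi with h2 | h2
      · exact Polynomial.coeff_eq_zero_of_lt_natTrailingDegree (h ▸ h2)
      · exact Polynomial.coeff_eq_zero_of_natDegree_lt h2
    · rw [Finset.sum_eq_zero, homogeneousComponent_eq_zero]
      · simpa using hm
      intro i hi
      rw [← coeff_dilate]
      apply Polynomial.coeff_eq_zero_of_lt_natTrailingDegree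
      rw [← h]
      simp at hm hi
      omega
  have h2 := homogeneousComponent_isHomogeneous (dilate f).natDegree f
  rwa [h1] at h2

theorem dilate_ne_zero {f : PolyRing K} (hf : f ≠ 0) : dilate f ≠ 0 := by
  intro h
  apply hf
  rw [← sum_homogeneousComponent f]
  exact Finset.sum_eq_zero fun i _ => by rw [← coeff_dilate, h, Polynomial.coeff_zero]

/-- Factors of a nonzero form are forms. -/
theorem exists_isHomogeneous_factors {a b : PolyRing K} {n : ℕ} (h : (a * b).IsHomogeneous n)
    (h0 : a * b ≠ 0) : ∃ i j, a.IsHomogeneous i ∧ b.IsHomogeneous j ∧ i + j = n := by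
  have ha := dilate_ne_zero (left_ne_zero_of_mul h0)
  have hb := dilate_ne_zero (right_ne_zero_of_mul h0)
  have h1 := dilate_of_isHomogeneous h
  rw [map_mul] at h1
  -- Degree and trailing degree in `T` are both additive and agree on the product, so they agree on
  -- each factor.
  have h2 := congrArg Polynomial.natDegree h1
  have h3 := congrArg Polynomial.natTrailingDegree h1
  rw [Polynomial.natDegree_mul ha hb, Polynomial.natDegree_C_mul_X_pow _ _ h0] at h2
  rw [Polynomial.natTrailingDegree_mul ha hb, Polynomial.C_mul_X_pow_eq_monomial,
    Polynomial.natTrailingDegree_monomial h0] at h3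
  have h4 := Polynomial.natTrailingDegree_le_natDegree (dilate a)
  have h5 := Polynomial.natTrailingDegree_le_natDegree (dilate b)
  exact ⟨_, _, isHomogeneous_of_natDegree_eq (by omega), isHomogeneous_of_natDegree_eq (by omega),
    h2⟩

/-! ### Common divisors of the low-degree forms in a Gorenstein ideal. -/

/-- In a graded Gorenstein ideal containing the `k`-th powers of the variables, a nonzero form of
minimal degree divides all the forms of low degree. -/
theorem dvd_of_mem_gor [Infinite K] {φ : PolyRing K →ₗ[K] K} {e : ℤ} (hφ : SuppIn φ e) {k : ℕ}
    (hX : ∀ i, X i ^ k ∈ gor φ) {v u : ℕ} {θ α : PolyRing K} (hθ : θ.IsHomogeneous v)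
    (hθ0 : θ ≠ 0) (hθφ : θ ∈ gor φ)
    (hmin : ∀ i < v, ∀ f : PolyRing K, f.IsHomogeneous i → f ∈ gor φ → f = 0)
    (hα : α.IsHomogeneous u) (hαφ : α ∈ gor φ) (huv : (u + v + k : ℤ) - 2 ≤ e) : θ ∣ α := by
  by_cases hα0 : α = 0
  · rw [hα0]
    exact dvd_zero θ
  obtain ⟨a, b, d, hab, rfl, rfl⟩ := UniqueFactorizationMonoid.exists_reduced_factors θ hθ0 α
  obtain ⟨i, j, hd, ha, hij⟩ := exists_isHomogeneous_factors hθ hθ0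
  obtain ⟨i', j', hd', hb, hij'⟩ := exists_isHomogeneous_factors hα hα0
  obtain rfl := hd.inj_right hd' (left_ne_zero_of_mul hθ0)
  obtain ⟨c, hc⟩ := exists_nonzerodivisor (I := Ideal.span {a} ⊔ Ideal.span {b})
    (fun g => mem_of_X_mul_mem hab) k
  set κ : PolyRing K := ∑ i, C (c i) * X i ^ k with hκ
  have hκφ : κ ∈ gor φ := Submodule.sum_mem _ fun i _ => Ideal.mul_mem_left _ _ (hX i)
  have hκk : κ ∈ gr K (k : ℤ) := by
    refine Submodule.sum_mem _ fun i _ => ?_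
    rw [← smul_eq_C_mul]
    exact Submodule.smul_mem _ _ (X_pow_mem_gr i k)
  -- The colon by the common factor `d` contains the complete intersection `(a, b, κ)`, hence every
  -- form of the degree dual to that of `d`. So `d` itself is in the ideal, and minimality of `v`
  -- makes the cofactor `a` a constant.
  have hdφ : d ∈ gor φ := by
    rw [mem_gor_iff_of_mem_gr hφ (mem_gr_natCast.mpr hd)]
    intro g hg
    have hle : Ideal.span {a} ⊔ Ideal.span {b} ⊔ Ideal.span {κ} ≤ quot (gor φ) d := by
      simp only [sup_le_iff, Ideal.span_singleton_le_iff_mem, mem_quot]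
      exact ⟨⟨hθφ, hαφ⟩, Ideal.mul_mem_left _ _ hκφ⟩
    exact apply_eq_zero_of_mem_gor (hle (mem_complete_intersection (mem_gr_natCast.mpr ha)
      (mem_gr_natCast.mpr hb) hκk (right_ne_zero_of_mul hθ0) hab hc (by omega) (by omega)
      (by omega) (by omega) hg))
  have hj : j = 0 := by
    by_contra hj
    exact left_ne_zero_of_mul hθ0 (hmin i (by omega) d hd hdφ)
  subst hj
  obtain ⟨r, hr⟩ : ∃ r, a = C r := ⟨_, (totalDegree_eq_zero_iff_eq_C).mp
    (Nat.le_zero.mp ha.totalDegree_le)⟩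
  have hr0 : r ≠ 0 := by
    rintro rfl
    exact right_ne_zero_of_mul hθ0 (by rw [hr, map_zero])
  refine mul_dvd_mul_left d (IsUnit.dvd ?_)
  rw [hr]
  exact (isUnit_iff_ne_zero.mpr hr0).map C

/-! ### The monomial complete intersection, its links and the socle. -/

/-- The ideal `(x ^ k, y ^ k, z ^ k)`. -/
noncomputable def varPowers (K : Type*) [Field K] (k : ℕ) : Ideal (PolyRing K) :=
  Ideal.span (Set.range fun i => X i ^ k)

/-- The coefficient of `(x y z) ^ (k - 1)`. -/
noncomputable def topCoeff (K : Type*) [Field K] (k : ℕ) : PolyRing K →ₗ[K] K :=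
  lcoeff K (Finsupp.equivFunOnFinite.symm fun _ => k - 1)

theorem suppIn_topCoeff {k : ℕ} (hk : 1 ≤ k) : SuppIn (topCoeff K k) (3 * k - 3) := by
  intro f
  have h : (3 * k - 3 : ℤ) = ((3 * (k - 1) : ℕ) : ℤ) := by omega
  rw [h, comp_natCast, topCoeff, lcoeff_apply, lcoeff_apply, coeff_homogeneousComponent, if_pos]
  simp [Finsupp.degree_eq_sum]

theorem varPowers_eq_gor {k : ℕ} (hk : 1 ≤ k) : varPowers K k = gor (topCoeff K k) := by
  apply le_antisymm
  · rw [varPowers, Ideal.span_le]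
    rintro _ ⟨i, rfl⟩ g
    rw [topCoeff, lcoeff_apply]
    dsimp only
    rw [X_pow_eq_monomial, coeff_monomial_mul', if_neg]
    intro h
    have := h i
    simp at this
    omega
  · intro f hf
    have hgen : (Set.range fun i : Fin 3 => (X i ^ k : PolyRing K)) =
        (fun s => monomial s (1 : K)) '' Set.range fun i : Fin 3 => Finsupp.single i k := by
      rw [← Set.range_comp]
      congr 1
      ext1 i
      rw [X_pow_eq_monomial]
      rfl
    rw [varPowers, hgen, mem_ideal_span_monomial_image]
    intro d hd
    by_contra! hcon
    have hle : d ≤ Finsupp.equivFunOnFinite.symm fun _ : Fin 3 => k - 1 := by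
      intro i
      have h1 := hcon _ ⟨i, rfl⟩
      rw [Finsupp.single_le_iff] at h1
      simp
      omega
    -- Multiplying by the complementary monomial moves the coefficient at `d` to the top
    -- coefficient.
    have h2 := hf (monomial ((Finsupp.equivFunOnFinite.symm fun _ => k - 1) - d) 1)
    rw [topCoeff, lcoeff_apply] at h2
    nth_rw 1 [← add_tsub_cancel_of_le hle] at h2
    rw [coeff_mul_monomial, mul_one] at h2
    exact (mem_support_iff.mp hd) h2

theorem mem_span_X_of_mem_gr {n : ℤ} (hn : 0 < n) {f : PolyRing K} (hf : f ∈ gr K n) :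
    f ∈ Ideal.span (Set.range (X : Fin 3 → PolyRing K)) := by
  lift n to ℕ using hn.le
  rw [← Set.image_univ, mem_ideal_span_X_image]
  intro d hd
  have h := (mem_gr_natCast.mp hf).degree_eq_sum_deg_support hd
  by_contra! hcon
  have h0 : d = 0 := Finsupp.ext fun i => hcon i (Set.mem_univ i)
  rw [h0] at h
  simp at h
  omega

/-- The socle of a graded Gorenstein algebra lives in the top degree. -/
theorem mem_gor_of_X_mul_mem {φ : PolyRing K →ₗ[K] K} {e : ℤ} (hφ : SuppIn φ e) {s : ℤ}
    (hs : s < e) {f : PolyRing K} (hf : f ∈ gr K s) (h : ∀ i, X i * f ∈ gor φ) : f ∈ gor φ := by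
  rw [mem_gor_iff_of_mem_gr hφ hf]
  intro g hg
  have hle : Ideal.span (Set.range (X : Fin 3 → PolyRing K)) ≤ quot (gor φ) f := by
    rw [Ideal.span_le]
    rintro _ ⟨i, rfl⟩
    rw [SetLike.mem_coe, mem_quot, mul_comm]
    exact h i
  exact apply_eq_zero_of_mem_gor (hle (mem_span_X_of_mem_gr (by omega) hg))

/-- The linkage `(x ^ k, y ^ k, z ^ k) : F`, as a Gorenstein ideal. -/
theorem quot_varPowers {k : ℕ} (hk : 1 ≤ k) (F : PolyRing K) :
    quot (varPowers K k) F = gor (topCoeff K k ∘ₗ LinearMap.mulLeft K F) := by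
  rw [varPowers_eq_gor hk, quot_gor]

theorem isHomog_varPowers {k : ℕ} (hk : 1 ≤ k) : IsHomog (varPowers K k) := by
  rw [varPowers_eq_gor hk]
  exact isHomog_gor (suppIn_topCoeff hk)

theorem X_pow_mem_varPowers (i : Fin 3) (k : ℕ) : X i ^ k ∈ varPowers K k :=
  Ideal.subset_span ⟨i, rfl⟩

/-- The linked ideal has an element dividing all its forms of degree `u`, for small `u`. -/
theorem exists_common_divisor [Infinite K] {k : ℕ} (hk : 1 ≤ k) {F : PolyRing K}
    (hF : F ∈ gr K k) {u : ℤ} (hu : 2 * u ≤ k - 1) :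
    ∃ θ ∈ quot (varPowers K k) F, ∀ α ∈ gr K u, α ∈ quot (varPowers K k) F → θ ∣ α := by
  by_cases hex : ∃ v : ℕ, (v : ℤ) ≤ u ∧ ∃ θ : PolyRing K, θ.IsHomogeneous v ∧ θ ≠ 0 ∧
      θ ∈ quot (varPowers K k) F
  · classical
    obtain ⟨hv, θ, hθ, hθ0, hθJ⟩ := Nat.find_spec hex
    have hmin := fun i hi => Nat.find_min (m := i) hex hi
    set v := Nat.find hex
    have hφ := (suppIn_topCoeff (K := K) hk).comp_mulLeft hF
    refine ⟨θ, hθJ, fun α hα hαJ => ?_⟩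
    have hX : ∀ i, X i ^ k ∈ quot (varPowers K k) F := fun i =>
      le_quot _ _ (X_pow_mem_varPowers i k)
    rw [quot_varPowers hk] at hθJ hαJ hX hmin
    lift u to ℕ using by omega
    -- The socle degree is `2k - 3`, and `u + v + k - 2 ≤ 2u + k - 2 ≤ 2k - 3`.
    refine dvd_of_mem_gor hφ hX hθ hθ0 hθJ (fun i hi f hf hfJ => ?_) (mem_gr_natCast.mp hα) hαJ
      (by omega)
    by_contra hf0
    exact hmin i hi ⟨by omega, f, hf, hf0, hfJ⟩
  -- No nonzero form of degree at most `u` lies in the link, so `0` serves as divisor.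
  · refine ⟨0, Submodule.zero_mem _, fun α hα hαJ => ?_⟩
    rw [zero_dvd_iff]
    by_contra hα0
    rcases lt_or_ge u 0 with h | h
    · exact hα0 (eq_zero_of_mem_gr_neg h hα)
    · lift u to ℕ using h
      exact hex ⟨u, le_rfl, α, mem_gr_natCast.mp hα, hα0, hαJ⟩

/-- An almost complete intersection `(x ^ k, y ^ k, z ^ k, F)`, where `F` is a form of degree `k`,
has no socle in low degrees. -/
theorem mem_of_X_mul_mem_sup [Infinite K] {k : ℕ} (hk : 1 ≤ k) {F : PolyRing K} (hF : F ∈ gr K k)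
    {s : ℤ} (hs : 2 * s ≤ 3 * k - 5) {f : PolyRing K} (hf : f ∈ gr K s)
    (h : ∀ i, X i * f ∈ varPowers K k ⊔ Ideal.span {F}) :
    f ∈ varPowers K k ⊔ Ideal.span {F} := by
  have hc := isHomog_varPowers (K := K) hk
  have hp : ∀ i, ∃ p ∈ gr K (s + 1 - k), X i * f - F * p ∈ varPowers K k := by
    intro i
    obtain ⟨a, ha, b, hb, hab⟩ := Submodule.mem_sup.mp (h i)
    obtain ⟨b, rfl⟩ := Ideal.mem_span_singleton'.mp hb
    refine ⟨comp (s + 1 - k) b, comp_mem _ _, ?_⟩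
    have h1 := hc a ha (s + 1)
    have h2 := mul_mem_gr (X_mem_gr (K := K) i) hf
    rw [add_comm] at h2
    rw [← comp_self h2, ← hab, map_add, mul_comm b, comp_mul hF, add_sub_cancel_right]
    exact h1
  choose p hp hpc using hp
  have hu : ∀ i j, X i * p j - X j * p i ∈ gr K (s + 2 - k) := by
    intro i j
    have h1 := Submodule.sub_mem _ (mul_mem_gr (X_mem_gr (K := K) i) (hp j))
      (mul_mem_gr (X_mem_gr (K := K) j) (hp i))
    rwa [show (1 + (s + 1 - k) : ℤ) = s + 2 - k by ring] at h1
  have hJ : ∀ i j, X i * p j - X j * p i ∈ quot (varPowers K k) F := by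
    intro i j
    rw [mem_quot]
    have h1 := Submodule.sub_mem _ (Ideal.mul_mem_left _ (X j) (hpc i))
      (Ideal.mul_mem_left _ (X i) (hpc j))
    convert h1 using 1
    ring
  obtain ⟨θ, hθ, hdvd⟩ := exists_common_divisor hk hF (u := s + 2 - k) (by omega)
  -- The cross differences of `p`, divided by `θ`, form a Koszul cycle and thus the curl of some
  -- `q`; then `p - θ q` has zero cross differences and is a multiple of the variables.
  obtain ⟨q, w, hqw⟩ : ∃ q : Fin 3 → PolyRing K, ∃ w, ∀ i, p i = θ * q i + X i * w := by
    obtain ⟨α, hα⟩ := hdvd _ (hu 2 1) (hJ 2 1)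
    obtain ⟨β, hβ⟩ := hdvd _ (hu 0 2) (hJ 0 2)
    obtain ⟨γ, hγ⟩ := hdvd _ (hu 1 0) (hJ 1 0)
    by_cases hθ0 : θ = 0
    · rw [hθ0, zero_mul] at hβ hγ
      obtain ⟨w, hw⟩ := exists_of_X_mul_eq (p := p) (by linear_combination hγ)
        (by linear_combination -hβ)
      exact ⟨0, w, fun i => by simp [hw i]⟩
    · obtain ⟨q, hq0, hq1, hq2⟩ := exists_curl (α := α) (β := β) (γ := γ) (by
        apply mul_left_cancel₀ hθ0
        linear_combination -X 0 * hα - X 1 * hβ - X 2 * hγ)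
      obtain ⟨w, hw⟩ := exists_of_X_mul_eq (p := fun i => p i - θ * q i)
        (by linear_combination hγ + θ * hq2) (by linear_combination -hβ - θ * hq1)
      exact ⟨q, w, fun i => by linear_combination hw i⟩
  have hsoc : ∀ i, X i * (f - F * comp (s - k) w) ∈ varPowers K k := by
    intro i
    have h1 : X i * (f - F * w) ∈ varPowers K k := by
      have h2 := Submodule.add_mem _ (hpc i) (Ideal.mul_mem_right (q i) _ (mem_quot.mp hθ))
      convert h2 using 1
      rw [hqw i]
      ring
    have h2 := hc _ h1 (s + 1)
    rwa [comp_mul (X_mem_gr i), map_sub, add_sub_cancel_right, comp_mul hF, comp_self hf] at h2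
  rcases lt_or_ge s 0 with hs0 | hs0
  · rw [eq_zero_of_mem_gr_neg hs0 hf]
    exact Submodule.zero_mem _
  have hmem : f - F * comp (s - k) w ∈ varPowers K k := by
    rw [varPowers_eq_gor hk] at hsoc ⊢
    refine mem_gor_of_X_mul_mem (suppIn_topCoeff hk) (by omega) (s := s) ?_ hsoc
    refine Submodule.sub_mem _ hf ?_
    have := mul_mem_gr hF (comp_mem (s - k) w)
    rwa [add_sub_cancel] at this
  rw [← sub_add_cancel f (F * comp (s - k) w)]
  exact Submodule.add_mem_sup hmem (Ideal.mul_mem_right _ _ (Ideal.mem_span_singleton_self F))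

/-! ### Strict decrease of the Hilbert function in the second half. -/

theorem varPowers_eq_sup (k : ℕ) : varPowers K k =
    Ideal.span {X 0 ^ k} ⊔ Ideal.span {X 1 ^ k} ⊔ Ideal.span {X 2 ^ k} := by
  rw [varPowers, ← Ideal.span_union, ← Ideal.span_union]
  congr 1
  ext f
  simp only [Set.mem_range, Fin.exists_fin_succ, Set.mem_union, Set.mem_singleton_iff]
  simp [eq_comm, or_assoc]

theorem mem_span_X_pow_pair {k : ℕ} {f : PolyRing K} :
    f ∈ Ideal.span {(X 0 : PolyRing K) ^ k} ⊔ Ideal.span {X 1 ^ k} ↔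
      ∀ d ∈ f.support, k ≤ d 0 ∨ k ≤ d 1 := by
  have h : Ideal.span {(X 0 : PolyRing K) ^ k} ⊔ Ideal.span {X 1 ^ k} =
      Ideal.span ((fun s => monomial s (1 : K)) ''
        {Finsupp.single (0 : Fin 3) k, Finsupp.single 1 k}) := by
    rw [← Ideal.span_union, Set.image_pair, X_pow_eq_monomial, X_pow_eq_monomial]
    rfl
  rw [h, mem_ideal_span_monomial_image]
  simp

theorem mem_of_X_pow_mul_mem {k : ℕ} {f : PolyRing K}
    (h : X 2 ^ k * f ∈ Ideal.span {(X 0 : PolyRing K) ^ k} ⊔ Ideal.span {X 1 ^ k}) :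
    f ∈ Ideal.span {(X 0 : PolyRing K) ^ k} ⊔ Ideal.span {X 1 ^ k} := by
  rw [mem_span_X_pow_pair] at h ⊢
  intro d hd
  have h1 := h (Finsupp.single 2 k + d) (by
    rw [MvPolynomial.mem_support_iff, X_pow_eq_monomial, coeff_monomial_mul, one_mul]
    exact MvPolynomial.mem_support_iff.mp hd)
  simpa using h1

theorem isRelPrime_X_pow (k : ℕ) : IsRelPrime (X 0 ^ k : PolyRing K) (X 1 ^ k) := by
  refine IsRelPrime.pow ?_
  refine (MvPolynomial.X_prime (i := (0 : Fin 3))).irreducible.isRelPrime_iff_not_dvd.mpr ?_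
  rw [X_dvd_X]
  decide

theorem hf_varPowers (k : ℕ) (n : ℤ) : hf (varPowers K k) n =
    finrank K (gr K n) - 3 * finrank K (gr K (n - k)) + 3 * finrank K (gr K (n - k - k)) -
      finrank K (gr K (n - k - k - k)) := by
  rw [varPowers_eq_sup, hf_complete_intersection (X_pow_mem_gr 0 k) (X_pow_mem_gr 1 k)
    (X_pow_mem_gr 2 k) (pow_ne_zero _ (X_ne_zero 0)) (isRelPrime_X_pow k)
    fun f => mem_of_X_pow_mul_mem]
  ring

theorem mem_varPowers_of_mem_gr {k : ℕ} {n : ℤ} (hn : 3 * k - 2 ≤ n) {f : PolyRing K}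
    (hf : f ∈ gr K n) : f ∈ varPowers K k := by
  rw [varPowers_eq_sup]
  exact mem_complete_intersection (X_pow_mem_gr 0 k) (X_pow_mem_gr 1 k)
    (X_pow_mem_gr 2 k) (pow_ne_zero _ (X_ne_zero 0)) (isRelPrime_X_pow k)
    (fun f => mem_of_X_pow_mul_mem) (by omega) (by omega) (by omega) (by omega) hf

theorem finrank_gr_of_neg {n : ℤ} (h : n < 0) : finrank K (gr K n) = 0 := by
  rw [gr_of_neg h]
  simp

/-- The Hilbert function of a nonzero ideal is strictly increasing where it does not vanish. -/
theorem finrank_piece_lt {I : Ideal (PolyRing K)} {n : ℤ} (h : piece I n ≠ ⊥) :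
    finrank K (piece I (n - 1)) < finrank K (piece I n) := by
  set μ := LinearMap.mulLeft K (X 2 : PolyRing K) with hμ
  have hinj : Function.Injective μ := fun f g hfg => mul_left_cancel₀ (X_ne_zero 2) hfg
  have hmap : ∀ i : Fin 3, ∀ f ∈ piece I (n - 1), X i * f ∈ piece I n := by
    rintro i f ⟨hf1, hf2⟩
    refine ⟨?_, Ideal.mul_mem_left _ _ hf2⟩
    have := mul_mem_gr (X_mem_gr (K := K) i) hf1
    rwa [add_sub_cancel] at this
  have hle : (piece I (n - 1)).map μ ≤ piece I n := by
    rintro _ ⟨f, hf, rfl⟩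
    exact hmap 2 f hf
  have hrank : finrank K ((piece I (n - 1)).map μ) = finrank K (piece I (n - 1)) :=
    (Submodule.equivMapOfInjective μ hinj _).finrank_eq.symm
  rw [← hrank]
  by_contra hlt
  have heq := Submodule.eq_of_le_of_finrank_le hle (not_lt.mp hlt)
  -- Equality would make every `f` in degree `n` equal to `X 2 * g` with `g` in the ideal; since `X
  -- 0 * g` is again in degree `n`, divisibility by `X 2` improves indefinitely.
  have hdvd : ∀ m : ℕ, ∀ f ∈ piece I n, (X 2 : PolyRing K) ^ m ∣ f := by
    intro m
    induction m with
    | zero => intro f _; simp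
    | succ m ih =>
      intro f hf
      rw [← heq] at hf
      obtain ⟨g, hg, rfl⟩ := hf
      have h1 := ih _ (hmap 0 g hg)
      have h2 : (X 2 : PolyRing K) ^ m ∣ g :=
        (MvPolynomial.X_prime (i := (2 : Fin 3))).pow_dvd_of_dvd_mul_left m
          (fun h' => absurd (X_dvd_X.mp h') (by decide)) h1
      rw [pow_succ, mul_comm]
      exact mul_dvd_mul_left _ h2
  apply h
  rw [eq_bot_iff]
  intro f hf
  obtain ⟨q, hq⟩ := hdvd (n.toNat + 1) f hf
  have h1 := comp_self hf.1
  rw [hq, comp_mul (X_pow_mem_gr 2 _), comp_of_neg (by push_cast; omega), mul_zero] at h1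
  rw [Submodule.mem_bot, hq, ← h1]

/-- The Hilbert function of `(x ^ k, y ^ k, z ^ k, F)` is strictly decreasing in the second half. -/
theorem hf_sup_lt [Infinite K] {k : ℕ} (hk : 1 ≤ k) {F : PolyRing K} (hF : F ∈ gr K k) {δ : ℤ}
    (hδ : 3 * k - 3 ≤ 2 * δ) (h0 : hf (varPowers K k ⊔ Ideal.span {F}) δ ≠ 0) :
    hf (varPowers K k ⊔ Ideal.span {F}) (δ + 1) < hf (varPowers K k ⊔ Ideal.span {F}) δ := by
  have e1 := hf_exact (isHomog_varPowers (K := K) hk) hF δ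
  have e2 := hf_exact (isHomog_varPowers (K := K) hk) hF (δ + 1)
  have hφ := (suppIn_topCoeff (K := K) hk).comp_mulLeft hF
  rcases le_or_gt δ (2 * k - 2) with hle | hlt
  · have h1 := hf_gor_mono hφ (i := δ - k) (by omega)
    rw [← quot_varPowers hk, show δ - k + 1 = δ + 1 - k by ring] at h1
    rw [hf_varPowers, finrank_gr_of_neg (n := δ - k - k - k) (by omega),
      finrank_gr_of_neg (n := δ - k - k) (by omega)] at e1
    rw [hf_varPowers, finrank_gr_of_neg (n := δ + 1 - k - k - k) (by omega),
      finrank_gr_of_neg (n := δ + 1 - k - k) (by omega)] at e2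
    have t := fun (m : ℤ) (hm : -2 ≤ m) => two_mul_finrank_gr (K := K) hm
    have t1 := t δ (by omega)
    have t2 := t (δ + 1) (by omega)
    have t3 := t (δ - k) (by omega)
    have t4 := t (δ + 1 - k) (by omega)
    push_cast at e1 e2
    -- The first difference of the Hilbert function of `R/c` here is `3k - 4 - 2δ ≤ -1`, and the
    -- subtracted Gorenstein term does not decrease.
    nlinarith
  -- Both Gorenstein terms reflect to degree `3k - 3 - m < k`, where `c` has no nonzero forms; the
  -- difference is the dimension of the link in that degree.
  · have key : ∀ m : ℤ, 2 * k - 2 ≤ m → hf (varPowers K k) m = hf (varPowers K k ⊔ Ideal.span {F}) m +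
        hf (quot (varPowers K k) F) (m - k) → hf (varPowers K k ⊔ Ideal.span {F}) m =
          finrank K (piece (quot (varPowers K k) F) (3 * k - 3 - m)) := by
      intro m hm e
      have s1 : hf (varPowers K k) m = hf (varPowers K k) (3 * k - 3 - m) := by
        rw [varPowers_eq_gor hk]
        exact hf_gor_symm (suppIn_topCoeff hk) (by ring)
      have s2 : hf (quot (varPowers K k) F) (m - k) =
          hf (quot (varPowers K k) F) (3 * k - 3 - m) := by
        rw [quot_varPowers hk]
        exact hf_gor_symm hφ (by ring)
      rw [s1, s2, hf_varPowers, finrank_gr_of_neg (n := 3 * k - 3 - m - k) (by omega),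
        finrank_gr_of_neg (n := 3 * k - 3 - m - k - k) (by omega),
        finrank_gr_of_neg (n := 3 * k - 3 - m - k - k - k) (by omega)] at e
      have s3 : hf (quot (varPowers K k) F) (3 * k - 3 - m) = finrank K (gr K (3 * k - 3 - m)) -
        finrank K (piece (quot (varPowers K k) F) (3 * k - 3 - m)) := rfl
      push_cast at e
      linarith
    have k1 := key δ (by omega) e1
    have k2 := key (δ + 1) (by omega) e2
    rw [k1] at h0 ⊢
    rw [k2, show (3 * k - 3 - (δ + 1) : ℤ) = 3 * k - 3 - δ - 1 by ring]
    refine Nat.cast_lt.mpr (finrank_piece_lt fun hbot => h0 ?_)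
    rw [hbot]
    simp

/-! ### Change of coordinates and transfer to powers of linear forms. -/

theorem exists_sum_smul_of_mem_gr_one {N : Fin 3 → PolyRing K} (hN : ∀ i, N i ∈ gr K 1)
    (hli : LinearIndependent K N) {f : PolyRing K} (hf : f ∈ gr K 1) :
    ∃ c : Fin 3 → K, ∑ i, c i • N i = f := by
  have hle : Submodule.span K (Set.range N) ≤ gr K 1 := by
    rw [Submodule.span_le]
    rintro _ ⟨i, rfl⟩
    exact hN i
  have hrank : finrank K (gr K (1 : ℤ)) = 3 := by
    have := finrank_gr_natCast (K := K) 1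
    simpa using this
  have heq := Submodule.eq_of_le_of_finrank_le hle (by
    rw [finrank_span_eq_card hli, hrank]
    simp)
  rw [← heq] at hf
  exact (Submodule.mem_span_range_iff_exists_fun K).mp hf

theorem aeval_mem_gr {N : Fin 3 → PolyRing K} (hN : ∀ i, N i ∈ gr K 1) {n : ℤ} {f : PolyRing K}
    (hf : f ∈ gr K n) : aeval N f ∈ gr K n := by
  rcases lt_or_ge n 0 with h | h
  · rw [eq_zero_of_mem_gr_neg h hf, map_zero]
    exact Submodule.zero_mem _
  · lift n to ℕ using h
    rw [mem_gr_natCast] at hf ⊢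
    have := hf.aeval N (n := 1) fun i => (mem_gr_natCast (n := 1)).mp (by exact_mod_cast hN i)
    rwa [one_mul] at this

/-- Linear changes of coordinates. -/
theorem exists_algEquiv {N : Fin 3 → PolyRing K} (hN : ∀ i, N i ∈ gr K 1)
    (hli : LinearIndependent K N) : ∃ ψ : PolyRing K ≃ₐ[K] PolyRing K, (∀ i, ψ (X i) = N i) ∧
      (∀ n, ∀ f ∈ gr K n, ψ f ∈ gr K n) ∧ ∀ n, ∀ f ∈ gr K n, ψ.symm f ∈ gr K n := by
  choose a ha using fun i => exists_sum_smul_of_mem_gr_one hN hli (X_mem_gr (K := K) i)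
  let P : Fin 3 → PolyRing K := fun i => ∑ j, a i j • X j
  have hP : ∀ i, P i ∈ gr K 1 := fun i =>
    Submodule.sum_mem _ fun j _ => Submodule.smul_mem _ _ (X_mem_gr j)
  have h1 : (aeval N).comp (aeval P) = AlgHom.id K (PolyRing K) := by
    ext1 i
    simp [P, ha]
  have hX : LinearIndependent K (X : Fin 3 → PolyRing K) := linearIndependent_X (Fin 3) K
  have h2 : (aeval P).comp (aeval N) = AlgHom.id K (PolyRing K) := by
    ext1 i
    obtain ⟨c, hc⟩ := exists_sum_smul_of_mem_gr_one (N := X) (fun i => X_mem_gr i) hX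
      (aeval_mem_gr hP (hN i))
    have h3 := congrArg (aeval N) hc
    rw [← AlgHom.comp_apply, h1, AlgHom.id_apply, map_sum] at h3
    simp only [map_smul, aeval_X] at h3
    have h4 : ∑ j, (c j - Pi.single (M := fun _ => K) i 1 j) • N j = 0 := by
      simp [sub_smul, Finset.sum_sub_distrib, h3, Pi.single_apply]
    have h5 := Fintype.linearIndependent_iff.mp hli _ h4
    rw [AlgHom.comp_apply, aeval_X, ← hc, AlgHom.id_apply]
    simp only [sub_eq_zero] at h5
    simp [h5, Pi.single_apply]
  exact ⟨AlgEquiv.ofAlgHom (aeval N) (aeval P) h1 h2, fun i => aeval_X N i,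
    fun n f hf => aeval_mem_gr hN hf, fun n f hf => aeval_mem_gr hP hf⟩

theorem component_eq_map (I : Ideal (PolyRing K)) (d : ℤ) :
    component I d = (gr K d).map (Ideal.Quotient.mkₐ K I).toLinearMap := by
  cases d with
  | ofNat n =>
    rw [Int.ofNat_eq_natCast, gr_natCast]
    rfl
  | negSucc n =>
    rw [gr_of_neg (Int.negSucc_lt_zero n), Submodule.map_bot]
    rfl

theorem cast_hilbert (I : Ideal (PolyRing K)) (d : ℤ) : (hilbert I d : ℤ) = hf I d := by
  rw [hilbert, component_eq_map, finrank_map_gr]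

/-- The properties of `(L₁ ^ k, L₂ ^ k, L₃ ^ k, L₄ ^ k)` used in the sequel: vanishing in high degrees,
no socle in low degrees, decreasing Hilbert function in the second half. -/
theorem powerIdeal_properties [Infinite K] {k : ℕ} (hk : 1 ≤ k) {L : Fin 4 → PolyRing K}
    (hL : GeneralPosition L) :
    (∀ n : ℤ, 3 * k - 2 ≤ n → hf (powerIdeal L k) n = 0) ∧
    (∀ s : ℤ, 2 * s ≤ 3 * k - 5 → ∀ f ∈ gr K s, (∀ g ∈ gr K 1, g * f ∈ powerIdeal L k) →
      f ∈ powerIdeal L k) ∧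
    ∀ δ : ℤ, 3 * k - 3 ≤ 2 * δ → hf (powerIdeal L k) δ ≠ 0 →
      hf (powerIdeal L k) (δ + 1) < hf (powerIdeal L k) δ := by
  have hL1 : ∀ i, L i ∈ gr K 1 := fun i => by
    exact_mod_cast (mem_gr_natCast (n := 1)).mpr (hL.1 i)
  obtain ⟨ψ, hψX, hψ, hψ'⟩ := exists_algEquiv
    (N := fun t => L ((Fin.last 3).succAbove t)) (fun i => hL1 _) (hL.2 (Fin.last 3))
  have hLk : L (Fin.last 3) ^ k ∈ gr K (k : ℤ) := by
    have := ((hL.1 (Fin.last 3)).pow k)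
    rw [one_mul] at this
    exact mem_gr_natCast.mpr this
  set F := ψ.symm (L (Fin.last 3) ^ k) with hFdef
  have hF : F ∈ gr K (k : ℤ) := hψ' _ _ hLk
  have hI : ∀ f, ψ f ∈ powerIdeal L k ↔ f ∈ varPowers K k ⊔ Ideal.span {F} := by
    have hmap : (varPowers K k ⊔ Ideal.span {F}).map (ψ : PolyRing K →+* PolyRing K) =
        powerIdeal L k := by
      rw [varPowers, ← Ideal.span_union, Ideal.map_span, powerIdeal]
      congr 1
      ext f
      simp only [Set.image_union, Set.image_singleton, Set.mem_union, Set.mem_singleton_iff,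
        Set.mem_image, Set.mem_range, exists_exists_eq_and]
      constructor
      · rintro (⟨i, rfl⟩ | rfl)
        · exact ⟨(Fin.last 3).succAbove i, by simp [hψX]⟩
        · exact ⟨Fin.last 3, by simp [hFdef]⟩
      · rintro ⟨i, rfl⟩
        induction i using Fin.lastCases with
        | last => exact Or.inr (by simp [hFdef])
        | cast i =>
          refine Or.inl ⟨i, ?_⟩
          rw [← Fin.succAbove_last_apply, ← hψX]
          simp
    intro f
    rw [← hmap]
    constructor
    · intro h
      obtain ⟨g, hg, hgf⟩ := (Ideal.mem_map_iff_of_surjective _ ψ.surjective).mp h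
      rwa [← ψ.injective hgf]
    · exact fun h => Ideal.mem_map_of_mem _ h
  have hhf : ∀ n, hf (powerIdeal L k) n = hf (varPowers K k ⊔ Ideal.span {F}) n := by
    intro n
    have h : piece (powerIdeal L k) n =
        (piece (varPowers K k ⊔ Ideal.span {F}) n).map ψ.toLinearEquiv.toLinearMap := by
      ext f
      constructor
      · rintro ⟨h1, h2⟩
        refine ⟨ψ.symm f, ⟨hψ' _ _ h1, ?_⟩, by simp⟩
        rw [Submodule.coe_restrictScalars, SetLike.mem_coe, ← hI]
        simpa using h2
      · rintro ⟨g, ⟨h1, h2⟩, rfl⟩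
        exact ⟨hψ _ _ h1, (hI g).mpr h2⟩
    rw [hf, hf, h, LinearEquiv.finrank_map_eq]
  refine ⟨fun n hn => ?_, fun s hs f hf hsoc => ?_, fun δ hδ h0 => ?_⟩
  · rw [hhf, hf_eq_zero_iff]
    exact fun f hf => Ideal.mem_sup_left (mem_varPowers_of_mem_gr hn hf)
  · have h := mem_of_X_mul_mem_sup hk hF hs (hψ' _ _ hf) fun i => by
      rw [← hI, map_mul, hψX, AlgEquiv.apply_symm_apply]
      exact hsoc _ (hL1 _)
    rw [← hI, AlgEquiv.apply_symm_apply] at h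
    exact h
  · rw [hhf] at h0
    rw [hhf, hhf]
    exact hf_sup_lt hk hF hδ h0

theorem hf_powerIdeal_zero_ne_zero {k : ℕ} (hk : 1 ≤ k) {L : Fin 4 → PolyRing K}
    (hL : GeneralPosition L) : hf (powerIdeal L k) 0 ≠ 0 := by
  intro h
  have h0 : (1 : PolyRing K) ∈ gr K 0 := by
    exact_mod_cast (mem_gr_natCast (n := 0)).mpr (isHomogeneous_one (Fin 3) K)
  have h1 := hf_eq_zero_iff.mp h 1 h0
  have hle : powerIdeal L k ≤ RingHom.ker (constantCoeff : PolyRing K →+* K) := by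
    rw [powerIdeal, Ideal.span_le]
    rintro _ ⟨i, rfl⟩
    rw [SetLike.mem_coe, RingHom.mem_ker, map_pow, constantCoeff_eq,
      (hL.1 i).coeff_eq_zero (by simp), zero_pow (by omega)]
  have h2 := hle h1
  simp at h2

/-! ### Propagation of injectivity and surjectivity. -/

theorem exists_eq_sum_X_mul {n : ℤ} (hn : 0 ≤ n) {f : PolyRing K} (hf : f ∈ gr K (n + 1)) :
    ∃ g : Fin 3 → PolyRing K, (∀ i, g i ∈ gr K n) ∧ f = ∑ i, X i * g i := by
  obtain ⟨c, hc⟩ := Ideal.mem_span_range_iff_exists_fun.mp (mem_span_X_of_mem_gr (by omega) hf)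
  refine ⟨fun i => comp n (c i), fun i => comp_mem _ _, ?_⟩
  conv_lhs => rw [← comp_self hf, ← hc, map_sum]
  refine Finset.sum_congr rfl fun i _ => ?_
  rw [mul_comm, comp_mul (X_mem_gr i), add_sub_cancel_right]

theorem hf_succ_eq_zero {I : Ideal (PolyRing K)} {n : ℤ} (hn : 0 ≤ n) (h : hf I n = 0) :
    hf I (n + 1) = 0 := by
  rw [hf_eq_zero_iff] at h ⊢
  intro f hf
  obtain ⟨g, hg, rfl⟩ := exists_eq_sum_X_mul hn hf
  exact Submodule.sum_mem _ fun i _ => Ideal.mul_mem_left _ _ (h _ (hg i))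

theorem injective_mulPow_iff {I : Ideal (PolyRing K)} {M : PolyRing K} (hM : M.IsHomogeneous 1)
    {j : ℕ} {d : ℤ} : Function.Injective (mulPow I hM j d) ↔
      ∀ f ∈ gr K (d - j), M ^ j * f ∈ I → f ∈ I := by
  rw [injective_iff_map_eq_zero]
  constructor
  · intro h f hf hfI
    have h1 : Ideal.Quotient.mk I f ∈ component I (d - j) := by
      rw [component_eq_map]
      exact ⟨f, hf, rfl⟩
    have h2 := h ⟨_, h1⟩ (Subtype.ext (by
      simp only [mulPow, LinearMap.coe_restrict_apply, LinearMap.mulLeft_apply]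
      rw [← map_pow, ← map_mul]
      exact Ideal.Quotient.eq_zero_iff_mem.mpr hfI))
    exact Ideal.Quotient.eq_zero_iff_mem.mp (congrArg Subtype.val h2)
  · rintro h ⟨x, hx⟩ h0
    rw [component_eq_map] at hx
    obtain ⟨f, hf, rfl⟩ := hx
    have h1 := congrArg Subtype.val h0
    simp only [mulPow, LinearMap.coe_restrict_apply, LinearMap.mulLeft_apply] at h1
    refine Subtype.ext (Ideal.Quotient.eq_zero_iff_mem.mpr (h f hf ?_))
    rw [← Ideal.Quotient.eq_zero_iff_mem, map_mul, map_pow]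
    exact h1

theorem surjective_mulPow_iff {I : Ideal (PolyRing K)} {M : PolyRing K} (hM : M.IsHomogeneous 1)
    {j : ℕ} {d : ℤ} : Function.Surjective (mulPow I hM j d) ↔
      ∀ g ∈ gr K d, ∃ f ∈ gr K (d - j), M ^ j * f - g ∈ I := by
  constructor
  · intro h g hg
    have h1 : Ideal.Quotient.mk I g ∈ component I d := by
      rw [component_eq_map]
      exact ⟨g, hg, rfl⟩
    obtain ⟨⟨x, hx⟩, hxg⟩ := h ⟨_, h1⟩
    rw [component_eq_map] at hx
    obtain ⟨f, hf, rfl⟩ := hx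
    refine ⟨f, hf, Ideal.Quotient.eq.mp ?_⟩
    have h2 := congrArg Subtype.val hxg
    simp only [mulPow, LinearMap.coe_restrict_apply, LinearMap.mulLeft_apply] at h2
    rw [map_mul, map_pow]
    exact h2
  · rintro h ⟨y, hy⟩
    have hy' := hy
    rw [component_eq_map] at hy'
    obtain ⟨g, hg, rfl⟩ := hy'
    obtain ⟨f, hf, hfg⟩ := h g hg
    have h1 : Ideal.Quotient.mk I f ∈ component I (d - j) := by
      rw [component_eq_map]
      exact ⟨f, hf, rfl⟩
    refine ⟨⟨_, h1⟩, Subtype.ext ?_⟩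
    simp only [mulPow, LinearMap.coe_restrict_apply, LinearMap.mulLeft_apply]
    rw [← map_pow, ← map_mul]
    exact Ideal.Quotient.eq.mpr hfg

/-- Surjectivity propagates to higher degrees. -/
theorem surjective_mulPow_of_le {I : Ideal (PolyRing K)} {M : PolyRing K}
    (hM : M.IsHomogeneous 1) {j : ℕ} {b d : ℤ} (hb : 0 ≤ b) (hbd : b ≤ d)
    (h : Function.Surjective (mulPow I hM j b)) : Function.Surjective (mulPow I hM j d) := by
  obtain ⟨i, hi⟩ := Int.le.dest hbd
  induction i generalizing d with
  | zero =>
    obtain rfl : b = d := by simpa using hi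
    exact h
  | succ i ih =>
    have ih := (surjective_mulPow_iff hM).mp (ih (d := d - 1) (by omega) (by push_cast at hi; omega))
    rw [surjective_mulPow_iff]
    intro g hg
    rw [← sub_add_cancel d 1] at hg
    obtain ⟨p, hp, rfl⟩ := exists_eq_sum_X_mul (by omega) hg
    choose f hf hfp using fun t => ih (p t) (hp t)
    refine ⟨∑ t, X t * f t, Submodule.sum_mem _ fun t _ => ?_, ?_⟩
    · have := mul_mem_gr (X_mem_gr (K := K) t) (hf t)
      rwa [show (1 + (d - 1 - j) : ℤ) = d - j by ring] at this
    · rw [Finset.mul_sum, ← Finset.sum_sub_distrib]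
      refine Submodule.sum_mem _ fun t _ => ?_
      convert Ideal.mul_mem_left _ (X t) (hfp t) using 1
      ring

/-- Injectivity propagates to lower degrees in the absence of socle. -/
theorem injective_mulPow_of_le {I : Ideal (PolyRing K)} {M : PolyRing K}
    (hM : M.IsHomogeneous 1) {j : ℕ} {a d : ℤ} (hda : d ≤ a)
    (hsoc : ∀ s : ℤ, s < a - j → ∀ f ∈ gr K s, (∀ g ∈ gr K 1, g * f ∈ I) → f ∈ I)
    (h : Function.Injective (mulPow I hM j a)) : Function.Injective (mulPow I hM j d) := by
  obtain ⟨i, hi⟩ := Int.le.dest hda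
  induction i generalizing d with
  | zero =>
    obtain rfl : d = a := by simpa using hi
    exact h
  | succ i ih =>
    have ih := (injective_mulPow_iff hM).mp (ih (d := d + 1) (by omega) (by push_cast at hi; omega))
    rw [injective_mulPow_iff]
    intro f hf hfI
    refine hsoc (d - j) (by omega) f hf fun g hg => ih _ ?_ ?_
    · have := mul_mem_gr hg hf
      rwa [show (1 + (d - j) : ℤ) = d + 1 - j by ring] at this
    · rw [mul_left_comm]
      exact Ideal.mul_mem_left _ _ hfI

end LefschetzPowers

/-! ### The main theorem. -/

open LefschetzPowers in
theorem corollary3p4 {K : Type*} [Field K] [Infinite K] (k : ℕ) (hk : 3 ≤ k)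
    (L : Fin 4 → LefschetzPowers.PolyRing K) (hL : LefschetzPowers.GeneralPosition L)
    (M : LefschetzPowers.PolyRing K) (hM : M.IsHomogeneous 1) (j : ℕ) (hj : 2 ≤ j) :
    (∃ a : ℤ, IsGreatest
      (LefschetzPowers.nondecreasingDegrees (LefschetzPowers.powerIdeal L k) j) a) ∧
    (∃ b : ℤ, IsLeast
      (LefschetzPowers.nonincreasingDegrees (LefschetzPowers.powerIdeal L k) j) b) ∧
    ∀ a b : ℤ,
      IsGreatest (LefschetzPowers.nondecreasingDegrees (LefschetzPowers.powerIdeal L k) j) a →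
      IsLeast (LefschetzPowers.nonincreasingDegrees (LefschetzPowers.powerIdeal L k) j) b →
      Function.Injective (LefschetzPowers.mulPow (LefschetzPowers.powerIdeal L k) hM j a) →
      Function.Surjective (LefschetzPowers.mulPow (LefschetzPowers.powerIdeal L k) hM j b) →
      ∀ d : ℤ, LefschetzPowers.HasMaximalRank (LefschetzPowers.powerIdeal L k) hM j d := by
  obtain ⟨hhigh, hsoc, hdec⟩ := powerIdeal_properties (k := k) (by omega) hL
  have h00 := hf_powerIdeal_zero_ne_zero (k := k) (by omega) hL
  have hneg : ∀ n < 0, hf (powerIdeal L k) n = 0 := fun n hn => hf_of_neg _ hn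
  have hnon : ∀ n, 0 ≤ hf (powerIdeal L k) n := hf_nonneg _
  have hsucc : ∀ n, 0 ≤ n → hf (powerIdeal L k) n = 0 → hf (powerIdeal L k) (n + 1) = 0 :=
    fun n hn => hf_succ_eq_zero hn
  have hinc : ∀ d, d ∈ nondecreasingDegrees (powerIdeal L k) j ↔
      hf (powerIdeal L k) (d - j) ≤ hf (powerIdeal L k) d ∧
        ¬(hf (powerIdeal L k) (d - j) = 0 ∧ hf (powerIdeal L k) d = 0) := by
    intro d
    simp only [nondecreasingDegrees, Set.mem_ofPred_eq, ← cast_hilbert]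
    norm_cast
  have hdecr : ∀ d, d ∈ nonincreasingDegrees (powerIdeal L k) j ↔
      hf (powerIdeal L k) d ≤ hf (powerIdeal L k) (d - j) ∧
        ¬(hf (powerIdeal L k) (d - j) = 0 ∧ hf (powerIdeal L k) d = 0) := by
    intro d
    simp only [nonincreasingDegrees, Set.mem_ofPred_eq, ← cast_hilbert, ge_iff_le]
    norm_cast
  refine ⟨?_, ?_, ?_⟩
  · obtain ⟨a, ha, hmax⟩ := Int.exists_greatest_of_bdd
      (P := fun d => d ∈ nondecreasingDegrees (powerIdeal L k) j)
      ⟨3 * k + j, fun d hd => by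
        by_contra hlt
        exact ((hinc d).mp hd).2 ⟨hhigh _ (by omega), hhigh _ (by omega)⟩⟩
      ⟨0, (hinc 0).mpr ⟨by rw [hneg _ (by omega)]; exact hnon 0, fun h => h00 h.2⟩⟩
    exact ⟨a, ha, fun d hd => hmax d hd⟩
  -- With `t` the last degree where `R/I` is nonzero, `t + j` witnesses that the set is nonempty.
  · obtain ⟨t, ht, hmax⟩ := Int.exists_greatest_of_bdd
      (P := fun d => hf (powerIdeal L k) d ≠ 0)
      ⟨3 * k, fun d hd => by
        by_contra hlt
        exact hd (hhigh _ (by omega))⟩ ⟨0, h00⟩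
    have ht' : hf (powerIdeal L k) (t + j) = 0 := by
      by_contra hne
      have := hmax _ hne
      omega
    obtain ⟨b, hb, hmin⟩ := Int.exists_least_of_bdd
      (P := fun d => d ∈ nonincreasingDegrees (powerIdeal L k) j)
      ⟨0, fun d hd => by
        by_contra hlt
        exact ((hdecr d).mp hd).2 ⟨hneg _ (by omega), hneg _ (by omega)⟩⟩
      ⟨t + j, (hdecr _).mpr ⟨by rw [ht']; exact hnon _, fun h => ht (by
        rw [← h.1, add_sub_cancel_right])⟩⟩
    exact ⟨b, hb, fun d hd => hmin d hd⟩
  · intro a b ha hb hinj hsurj d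
    have hb0 : 0 ≤ b := by
      by_contra hlt
      exact ((hdecr b).mp hb.1).2 ⟨hneg _ (by omega), hneg _ (by omega)⟩
    rcases le_or_gt b d with hbd | hdb
    · exact Or.inr (surjective_mulPow_of_le hM hb0 hbd hsurj)
    rcases le_or_gt d a with hda | had
    · left
      obtain ⟨hle, hne⟩ := (hinc a).mp ha.1
      by_cases h0 : hf (powerIdeal L k) (a - j) = 0
      -- Once zero in a nonnegative degree, `h` stays zero, which would give `h(a) = 0` as well.
      -- Hence all the sources in question are in negative degree.
      · have hneg' : a - j < 0 := by
          by_contra hge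
          have : ∀ i : ℕ, hf (powerIdeal L k) (a - j + i) = 0 := by
            intro i
            induction i with
            | zero => simpa using h0
            | succ i ih =>
              rw [Nat.cast_succ, ← add_assoc]
              exact hsucc _ (by omega) ih
          have h1 := this j
          rw [sub_add_cancel] at h1
          exact hne ⟨h0, h1⟩
        rw [injective_mulPow_iff]
        intro f hf _
        rw [eq_zero_of_mem_gr_neg (by omega) hf]
        exact Submodule.zero_mem _
      -- Otherwise `h` decreases strictly from `a - j` on, contradicting `h(a - j) ≤ h(a)`. The
      -- bound gives `2s ≤ 3k - 6` for `s < a - j`, within the socle-free range.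
      · have hδ : 2 * (a - j) ≤ 3 * (k : ℤ) - 4 := by
          by_contra hlt
          have : ∀ i : ℕ, hf (powerIdeal L k) (a - j + (i + 1)) < hf (powerIdeal L k) (a - j) := by
            intro i
            induction i with
            | zero => simpa using hdec _ (by omega) h0
            | succ i ih =>
              rw [Nat.cast_succ, ← add_assoc (a - j : ℤ)]
              by_cases hz : hf (powerIdeal L k) (a - j + (i + 1)) = 0
              · rw [hsucc _ (by omega) hz]
                exact lt_of_le_of_ne (hnon _) (Ne.symm h0)
              · exact (hdec _ (by omega) hz).trans ih
          have h1 := this (j - 1)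
          rw [show (a - j + ((j - 1 : ℕ) + 1) : ℤ) = a by omega] at h1
          omega
        exact injective_mulPow_of_le hM hda (fun s hs => hsoc s (by omega)) hinj
    · right
      -- If `h(d)` were nonzero, comparing it with `h(d - j)` would place `d` in one of the two
      -- sets, against `a < d < b`.
      have hz : hf (powerIdeal L k) d = 0 := by
        by_contra hne
        rcases le_total (hf (powerIdeal L k) (d - j)) (hf (powerIdeal L k) d) with h | h
        · exact absurd (ha.2 ((hinc d).mpr ⟨h, fun h' => hne h'.2⟩)) (by omega)
        · exact absurd (hb.2 ((hdecr d).mpr ⟨h, fun h' => hne h'.2⟩)) (by omega)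
      rw [surjective_mulPow_iff]
      intro g hg
      refine ⟨0, Submodule.zero_mem _, ?_⟩
      rw [mul_zero, zero_sub]
      exact Submodule.neg_mem _ (hf_eq_zero_iff.mp hz g hg)
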